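/- **Setting.** Let $n<d$. Training data: a feature matrix $A\in\mathbb R^{n\times d}$ whose rows are iid copies of a feature vector $a\in\mathbb R^d$ with law $P$, and outputs $Y=A\alpha^*+W$, where $W\sim\mathcal N(0,\sigma^2 I_n)$, $\sigma>0$, is independent of $A$ and $\alpha^*$ is $k$-sparse. The test MSE of $\widehat\alpha$ is $\mathcal E_{\mathsf{test}}(\widehat\alpha)=\mathbb E[(Y_{\mathsf{new}}-\langle a,\widehat\alpha\rangle)^2]-\sigma^2$, the expectation being over a fresh sample $Y_{\mathsf{new}}=\langle a,\alpha^*\rangle+W_{\mathsf{new}}$, with $a\sim P$ and $W_{\mathsf{new}}\sim\mathcal N(0,\sigma^2)$ independent. Basis pursuit (BP) means minimizing $\|\alpha\|_1$ subject to $A\alpha=Y$; a BP operator for $A$ chooses a BP solution for every $Y\in\mathbb R^n$. An operator $Y\mapsto\widehat\alpha(Y)$ with $A\widehat\alpha(Y)=Y$ for all $Y$ is *$1$-parsimonious* if, for every $Y\in\mathbb R^n$, $\|A\widehat\alpha_{\mathsf{trunc}}\|_2^2\ge\|Y\|_2^2$, where $\widehat\alpha_{\mathsf{trunc}}$ keeps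 the $n$ entries of $\widehat\alpha(Y)$ of largest absolute value (however ties are broken) and sets the others to $0$. Features are *whitened* if $\mathbb E[aa^\top]=I_d$, and *sub-Gaussian with parameter at most $K$* if $p^{-1/2}(\mathbb E|\langle a,v\rangle|^p)^{1/p}\le K\|v\|_2$ for all $v\in\mathbb R^d$ and all real $p\ge1$. Call $A$ *non-degenerate* if any $n$ distinct columns of $A$ are linearly independent and no hyperplane $\{x:\langle y,x\rangle=1\}$ contains, up to sign, more than $n$ of the columns. **Statement.** 1. If $\operatorname{rank}A=n$, there is a $1$-parsimonious BP operator for $A$ (no condition $n<d$ is needed here). 2. If $A$ is non-degenerate, then BP has a unique solution for every $Y\in\mathbb R^n$, the BP operator is $1$-parsimonious, and for every $\alpha^*\in\mathbb R^d$ and $\sigma>0$, almost surely over $W$, the BP solution for $Y=A\alpha^*+W$ has support of size exactly $n$. 3. $A$ is almost surely non-degenerate if $P$ has a density with respect to Lebesgue measure on $\mathbb R^d$, in particular if $P=\mathcal N(0,I_d)$. 4. (Gaussian features.) There is a universal constant $C>0$ such that for all $1\le n<d$, $\sigma>0$ and $k\ge0$, and for $P=\mathcal N(0,I_d)$, there is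 a $k$-sparse $\alpha^*$ such that for every $\delta>0$, with probability at least $1-e^{-n\ln(d/n)}-e^{-n\delta^2/2}$ over $(A,W)$, the BP solution $\widehat\alpha_{\mathsf{BP}}$ is unique, has support of size exactly $n$, and satisfies $$\mathcal E_{\mathsf{test}}(\widehat\alpha_{\mathsf{BP}})\ \ge\ \frac{\sigma^2(1-\delta)}{C\ln(d/n)}.$$ 5. (Sub-Gaussian features.) For every $K>0$ there is a constant $C>0$, depending only on $K$, such that for all $1\le n<d$, $\sigma>0$, every whitened $P$ that is sub-Gaussian with parameter at most $K$, and all $k\ge0$, there is a $k$-sparse $\alpha^*$ such that for every $\delta>0$: (a) with probability at least $1-e^{-n\ln(d/n)}-e^{-n\delta^2/2}$ over $(A,W)$, every $1$-parsimonious BP operator for $A$ (none exists when $\operatorname{rank}A<n$), applied to $Y$, gives $\widehat\alpha$ with $\mathcal E_{\mathsf{test}}(\widehat\alpha)\ge\sigma^2(1-\delta)/(C\ln(d/n))$; (b) if $A$ is almost surely non-degenerate, then with at least the same probability the BP solution is unique, has support of size exactly $n$, and satisfies the same lower bound. -/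

import Mathlib

open MeasureTheory ProbabilityTheory
open scoped Matrix

noncomputable section

/-! ### Vectors and interpolation -/

/-- The squared Euclidean norm of a vector. -/
def sqNorm {ι : Type*} [Fintype ι] (v : ι → ℝ) : ℝ := ∑ i, v i ^ 2

/-- The `ℓ¹` norm of a vector. -/
def l1Norm {ι : Type*} [Fintype ι] (v : ι → ℝ) : ℝ := ∑ i, |v i|

/-- The number of nonzero entries of a vector (the size of its support). -/
def l0Norm {ι : Type*} [Fintype ι] (v : ι → ℝ) : ℕ := {i | v i ≠ 0}.ncard

/-- `α` is a solution of the basis pursuit program: it has minimal `ℓ¹` norm among all vectors that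
satisfy the interpolation condition `A α = Y`. -/
def IsMinL1Interpolator {n d : ℕ} (A : Matrix (Fin n) (Fin d) ℝ) (Y : Fin n → ℝ)
    (α : Fin d → ℝ) : Prop :=
  A *ᵥ α = Y ∧ ∀ α' : Fin d → ℝ, A *ᵥ α' = Y → l1Norm α ≤ l1Norm α'

/-- `op` selects, for every output vector `Y`, a solution of the basis pursuit program. -/
def IsBPOperator {n d : ℕ} (A : Matrix (Fin n) (Fin d) ℝ)
    (op : (Fin n → ℝ) → (Fin d → ℝ)) : Prop :=
  ∀ Y, IsMinL1Interpolator A Y (op Y)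

/-- `S` is a set of indices of the top `n` absolute values of entries of `α`. -/
def IsTopSet {d : ℕ} (n : ℕ) (α : Fin d → ℝ) (S : Finset (Fin d)) : Prop :=
  S.card = n ∧ ∀ i ∈ S, ∀ j ∉ S, |α j| ≤ |α i|

/-- The vector `α` with the entries outside `S` replaced by zero. -/
def truncTo {d : ℕ} (S : Finset (Fin d)) (α : Fin d → ℝ) : Fin d → ℝ :=
  fun j => if j ∈ S then α j else 0

/-- `op` is a `β`-parsimonious interpolating operator for the data matrix `A`: it interpolates every
output, and the truncation of `op Y` to its top `n` entries (however ties are broken) captures at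
least the fraction `β` of the energy of `Y`. -/
def IsParsimonious {n d : ℕ} (A : Matrix (Fin n) (Fin d) ℝ) (β : ℝ)
    (op : (Fin n → ℝ) → (Fin d → ℝ)) : Prop :=
  (∀ Y, A *ᵥ op Y = Y) ∧
    ∀ Y, ∀ S : Finset (Fin d), IsTopSet n (op Y) S →
      β * sqNorm Y ≤ sqNorm (A *ᵥ truncTo S (op Y))

/-- Non-degeneracy of a data matrix: any `n` distinct columns form an invertible matrix, and no
hyperplane `{x | ⟨y, x⟩ = 1}` contains, up to sign, more than `n` of the columns. -/
def IsNondegenerate {n d : ℕ} (A : Matrix (Fin n) (Fin d) ℝ) : Prop :=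
  (∀ e : Fin n ↪ Fin d, IsUnit (A.submatrix id e)) ∧
    ∀ y : Fin n → ℝ, {j : Fin d | |(y ᵥ* A) j| = 1}.ncard ≤ n

/-! ### Feature distributions -/

/-- The law `P` of a feature vector is whitened: `𝔼[a aᵀ] = I`. -/
def IsWhitened {d : ℕ} (P : Measure (Fin d → ℝ)) : Prop :=
  ∀ i j : Fin d, ∫ a, a i * a j ∂P = if i = j then 1 else 0

/-- The random variable `X` is sub-Gaussian with parameter at most `K`:
`p^(-1/2) 𝔼[|X|^p]^(1/p) ≤ K` for all real `p ≥ 1`. -/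
def IsSubGaussianVar {Ω : Type*} [MeasurableSpace Ω] (μ : Measure Ω) (X : Ω → ℝ) (K : ℝ) : Prop :=
  ∀ p : ℝ, 1 ≤ p → eLpNorm X (ENNReal.ofReal p) μ ≤ ENNReal.ofReal (K * √p)

/-- A random vector with law `P` is sub-Gaussian with parameter at most `K`: so are all its
normalized one-dimensional marginals. -/
def IsSubGaussianVec {d : ℕ} (P : Measure (Fin d → ℝ)) (K : ℝ) : Prop :=
  ∀ v : Fin d → ℝ, IsSubGaussianVar P (fun a => (a ⬝ᵥ v) / √(sqNorm v)) K

/-- The standard Gaussian law `N(0, I)` on `ℝᵈ`: independent `N(0, 1)` entries. -/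
def gaussianFeatures (d : ℕ) : Measure (Fin d → ℝ) :=
  Measure.pi fun _ => gaussianReal 0 1

/-! ### The linear model -/

/-- The law `N(0, σ²)` of the noise in one sample. -/
def noiseLaw (σ : ℝ) : Measure ℝ := gaussianReal 0 ⟨σ ^ 2, sq_nonneg σ⟩

/-- The law of the training noise vector: `n` independent `N(0, σ²)` entries. -/
def trainNoise (n : ℕ) (σ : ℝ) : Measure (Fin n → ℝ) := Measure.pi fun _ => noiseLaw σ

/-- The law of the training feature matrix, given by its rows: `n` independent feature vectors with
law `P`. -/
def trainFeatures {d : ℕ} (P : Measure (Fin d → ℝ)) (n : ℕ) : Measure (Fin n → Fin d → ℝ) :=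
  Measure.pi fun _ => P

/-- The joint law of training features and training noise, which are independent. -/
def trainLaw {d : ℕ} (P : Measure (Fin d → ℝ)) (n : ℕ) (σ : ℝ) :
    Measure ((Fin n → Fin d → ℝ) × (Fin n → ℝ)) :=
  (trainFeatures P n).prod (trainNoise n σ)

/-- The training outputs `Y = A α* + W`. -/
def outputs {n d : ℕ} (A : Matrix (Fin n) (Fin d) ℝ) (αstar : Fin d → ℝ) (w : Fin n → ℝ) :
    Fin n → ℝ := A *ᵥ αstar + w

/-- The test MSE of `αhat`, minus the irreducible noise error: `𝔼[(Y - ⟨a, αhat⟩)²] - σ²`, over a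
fresh sample `Y = ⟨a, α*⟩ + W` with `a ∼ P` and `W ∼ N(0, σ²)` independent. -/
def testMSE {d : ℕ} (P : Measure (Fin d → ℝ)) (σ : ℝ) (αstar αhat : Fin d → ℝ) : ℝ :=
  (∫ z : (Fin d → ℝ) × ℝ, ((z.1 ⬝ᵥ αstar + z.2) - z.1 ⬝ᵥ αhat) ^ 2 ∂(P.prod (noiseLaw σ))) - σ ^ 2

/-- The lower bound `σ² (1 - δ) / (C ln (d / n))`. -/
def mseBound (n d : ℕ) (σ δ C : ℝ) : ℝ :=
  σ ^ 2 * (1 - δ) / (C * Real.log ((d : ℝ) / n))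

/-- The allowed failure probability `exp (-n ln (d / n)) + exp (-n δ² / 2)`. -/
def failProb (n d : ℕ) (δ : ℝ) : ENNReal :=
  ENNReal.ofReal (Real.exp (-(n * Real.log ((d : ℝ) / n))) + Real.exp (-(n * δ ^ 2 / 2)))

/-- The desired outcome on the training data `(A, w)`: the basis pursuit solution is unique, its
support has size exactly `n`, and its test MSE is at least `b`. -/
def BPOutcome {n d : ℕ} (P : Measure (Fin d → ℝ)) (σ : ℝ) (αstar : Fin d → ℝ) (b : ℝ)
    (A : Matrix (Fin n) (Fin d) ℝ) (w : Fin n → ℝ) : Prop :=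
  ∃ αhat : Fin d → ℝ,
    IsMinL1Interpolator A (outputs A αstar w) αhat ∧
    (∀ α', IsMinL1Interpolator A (outputs A αstar w) α' → α' = αhat) ∧
    l0Norm αhat = n ∧
    b ≤ testMSE P σ αstar αhat

end

/-! The lower bounds are proved with `α* = 0`, which is `k`-sparse for every `k`. Then `Y = W`, and
whitening turns the test error into `‖α̂‖²` (`IsWhitened.testMSE_zero`), so the task is to show that
an interpolator of pure noise is large. In these estimates both feature models enter only through
`HasSqExpMoment`, that is `𝔼 exp(c⟨a,v⟩²) ≤ 2` on the unit ball.

If `d ≥ 2n`, parsimony bounds `‖W‖²` by `‖A α_S‖²` for a set `S` of `n` columns. A union bound shows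
that all `n`-column submatrices have squared norm `O(n ln(d/n))`, while `‖W‖²` exceeds `nσ²(1-δ)/e`
up to probability `exp(-nδ²/2)`. Dividing gives the bound on `‖α‖²`.

If `n < d < 2n`, then `ln(d/n)` is comparable to `m/n` with `m = d - n`, and column norms are too
crude. Here every interpolator is large, parsimonious or not: `l‖α‖² ≥ Wᵀ N W` with `N = l(l +
AAᵀ)⁻¹`. For `l = m²/n`, a leave-one-out formula shows that `tr N` is at least a multiple of `m`
with high probability (`le_trace_ridgeResolvent_cogram`), and a lower-tail bound for `Wᵀ N W` that
sees only `tr N` concludes. The small-interpolator events are bounded in outer measure, so their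
measurability is never needed.

On the deterministic side, a sparsest basis pursuit solution has linearly independent support
columns, hence at most `n` entries, and truncation loses nothing. For non-degenerate `A`, a dual
vector confines the supports of any two solutions to a common set of `n` columns, which forces
uniqueness. Non-degeneracy, or a support of full size `n`, can fail only where some determinant
vanishes that is affine in each row (or in the noise) and not identically zero; such zero sets are
null (`ChargesNoHyperplane.ae_ne_zero_of_forall_affine`). -/

/-! ### Basis pursuit: existence, sparsity and uniqueness of solutions -/

section BasisPursuit

variable {n d : ℕ}

theorem l1Norm_nonneg {ι : Type*} [Fintype ι] (v : ι → ℝ) : 0 ≤ l1Norm v :=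
  Finset.sum_nonneg fun _ _ => abs_nonneg _

theorem sqNorm_nonneg {ι : Type*} [Fintype ι] (v : ι → ℝ) : 0 ≤ sqNorm v :=
  Finset.sum_nonneg fun _ _ => sq_nonneg _

theorem abs_apply_le_l1Norm {ι : Type*} [Fintype ι] (v : ι → ℝ) (i : ι) : |v i| ≤ l1Norm v :=
  Finset.single_le_sum (f := fun i => |v i|) (fun _ _ => abs_nonneg _) (Finset.mem_univ i)

theorem continuous_l1Norm {ι : Type*} [Fintype ι] : Continuous (l1Norm : (ι → ℝ) → ℝ) := by
  unfold l1Norm; fun_prop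

theorem mulVec_surjective_of_rank_eq {A : Matrix (Fin n) (Fin d) ℝ} (hA : A.rank = n)
    (Y : Fin n → ℝ) : ∃ α, A *ᵥ α = Y := by
  have h : LinearMap.range A.mulVecLin = ⊤ := by
    apply Submodule.eq_top_of_finrank_eq
    rw [← Matrix.rank, hA, Module.finrank_fin_fun]
  have : Y ∈ LinearMap.range A.mulVecLin := h ▸ Submodule.mem_top
  simpa using this

theorem exists_isMinL1Interpolator {A : Matrix (Fin n) (Fin d) ℝ} {Y : Fin n → ℝ}
    (h : ∃ α, A *ᵥ α = Y) : ∃ α, IsMinL1Interpolator A Y α := by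
  obtain ⟨α₀, h₀⟩ := h
  have hcl : IsClosed {α : Fin d → ℝ | A *ᵥ α = Y} :=
    isClosed_eq (by fun_prop) continuous_const
  have hK : IsCompact ({α : Fin d → ℝ | A *ᵥ α = Y} ∩ Metric.closedBall 0 (l1Norm α₀)) :=
    (isCompact_closedBall _ _).inter_left hcl
  have hle : ∀ α : Fin d → ℝ, l1Norm α ≤ l1Norm α₀ → α ∈ Metric.closedBall 0 (l1Norm α₀) := by
    intro α hα
    rw [mem_closedBall_zero_iff, pi_norm_le_iff_of_nonneg (l1Norm_nonneg _)]
    exact fun i => (abs_apply_le_l1Norm α i).trans hα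
  obtain ⟨α, hα, hmin⟩ := hK.exists_isMinOn ⟨α₀, h₀, hle _ le_rfl⟩
    continuous_l1Norm.continuousOn
  refine ⟨α, hα.1, fun α' h' => ?_⟩
  by_cases hb : l1Norm α' ≤ l1Norm α₀
  · exact hmin ⟨h', hle _ hb⟩
  · exact (hmin ⟨h₀, hle _ le_rfl⟩).trans (not_le.mp hb).le

theorem l1Norm_add_add_l1Norm_sub {ι : Type*} [Fintype ι] {α z : ι → ℝ}
    (h : ∀ i, |z i| ≤ |α i|) : l1Norm (α + z) + l1Norm (α - z) = 2 * l1Norm α := by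
  unfold l1Norm
  rw [← Finset.sum_add_distrib, Finset.mul_sum]
  refine Finset.sum_congr rfl fun i _ => ?_
  have := h i
  simp only [Pi.add_apply, Pi.sub_apply]
  grind

/-- Moving a basis pursuit solution inside its orthant along the kernel keeps it a solution. -/
theorem IsMinL1Interpolator.add {A : Matrix (Fin n) (Fin d) ℝ} {Y : Fin n → ℝ} {α z : Fin d → ℝ}
    (hα : IsMinL1Interpolator A Y α) (hz : A *ᵥ z = 0) (h : ∀ i, |z i| ≤ |α i|) :
    IsMinL1Interpolator A Y (α + z) := by
  have h1 : A *ᵥ (α + z) = Y := by rw [Matrix.mulVec_add, hz, hα.1, add_zero]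
  have h2 : A *ᵥ (α - z) = Y := by rw [Matrix.mulVec_sub, hz, hα.1, sub_zero]
  refine ⟨h1, fun α' h' => ?_⟩
  have := l1Norm_add_add_l1Norm_sub h
  have := hα.2 _ h2
  have := hα.2 _ h'
  linarith

/-- A solution of smallest support works: a kernel vector inside the support could be used to move
to another solution with one more zero. -/
theorem exists_isMinL1Interpolator_linearIndepOn {A : Matrix (Fin n) (Fin d) ℝ} {Y : Fin n → ℝ}
    (h : ∃ α, A *ᵥ α = Y) : ∃ α, IsMinL1Interpolator A Y α ∧
      ∀ z : Fin d → ℝ, A *ᵥ z = 0 → (∀ i, α i = 0 → z i = 0) → z = 0 := by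
  classical
  have hex : ∃ k, ∃ α, IsMinL1Interpolator A Y α ∧ l0Norm α = k :=
    let ⟨α, hα⟩ := exists_isMinL1Interpolator h
    ⟨_, α, hα, rfl⟩
  obtain ⟨α, hα, hk⟩ := Nat.find_spec hex
  refine ⟨α, hα, fun z hz hsupp => ?_⟩
  by_contra hne
  have hne' : (Finset.univ.filter fun j => z j ≠ 0).Nonempty := by
    by_contra hemp
    rw [Finset.not_nonempty_iff_eq_empty, Finset.filter_eq_empty_iff] at hemp
    exact hne (funext fun j => not_not.mp (hemp (Finset.mem_univ j)))
  obtain ⟨j, hj, hmin⟩ := Finset.exists_min_image _ (fun j => |α j / z j|) hne'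
  have hzj : z j ≠ 0 := by simpa using hj
  have hαj : α j ≠ 0 := fun h0 => hzj (hsupp j h0)
  -- The ratio of least modulus: moving by it kills entry `j` while no other entry crosses zero, so
  -- the `ℓ¹` norm stays minimal.
  set t : ℝ := -(α j / z j) with ht
  have hbound : ∀ i, |(t • z) i| ≤ |α i| := by
    intro i
    by_cases hi : z i = 0
    · simp [hi]
    · have := hmin i (by simpa using hi)
      rw [Pi.smul_apply, smul_eq_mul, abs_mul, ht, abs_neg]
      calc |α j / z j| * |z i| ≤ |α i / z i| * |z i| := by gcongr
        _ = |α i| := by rw [← abs_mul, div_mul_cancel₀ _ hi]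
  have hopt : IsMinL1Interpolator A Y (α + t • z) :=
    hα.add (by rw [Matrix.mulVec_smul, hz, smul_zero]) hbound
  have hlt : l0Norm (α + t • z) < l0Norm α := by
    refine Set.ncard_lt_ncard ⟨fun i hi => ?_, fun hsub => ?_⟩ (Set.toFinite _)
    · intro h0
      exact hi (by simp [h0, hsupp i h0])
    · refine hsub (show α j ≠ 0 from hαj) ?_
      simp [ht, div_mul_cancel₀ _ hzj]
  exact Nat.find_min hex (hk ▸ hlt) ⟨_, hopt, rfl⟩

/-- The hypothesis makes `A` injective on the coordinate subspace of the support, and its target has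
dimension `n`. -/
theorem l0Norm_le_of_forall_ker {A : Matrix (Fin n) (Fin d) ℝ} {α : Fin d → ℝ}
    (h : ∀ z : Fin d → ℝ, A *ᵥ z = 0 → (∀ i, α i = 0 → z i = 0) → z = 0) : l0Norm α ≤ n := by
  classical
  set s : Set (Fin d) := {i | α i ≠ 0} with hs
  let E : (s → ℝ) →ₗ[ℝ] (Fin d → ℝ) := Function.ExtendByZero.linearMap ℝ ((↑) : s → Fin d)
  have hE : ∀ x : s → ℝ, ∀ i : s, E x i = x i := fun x i =>
    Subtype.val_injective.extend_apply x 0 i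
  have hE0 : ∀ x : s → ℝ, ∀ i, i ∉ s → E x i = 0 := fun x i hi =>
    Function.extend_apply' _ _ _ (by rintro ⟨a, rfl⟩; exact hi a.2)
  have hinj : Function.Injective (A.mulVecLin ∘ₗ E) := by
    rw [← LinearMap.ker_eq_bot, LinearMap.ker_eq_bot']
    intro x hx
    have := h (E x) (by simpa using hx) (fun i hi => hE0 x i (by simpa [hs] using hi))
    funext i
    rw [← hE x i, this]; rfl
  have := LinearMap.finrank_le_finrank_of_injective hinj
  rw [Module.finrank_fintype_fun_eq_card, Module.finrank_fin_fun] at this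
  rw [l0Norm, ← hs, ← Nat.card_coe_set_eq, Nat.card_eq_fintype_card]
  exact this

/-- A nonzero entry outside a top set would make all `n` entries inside it nonzero, giving `n + 1`
nonzero entries. -/
theorem truncTo_eq_self_of_l0Norm_le {α : Fin d → ℝ} {S : Finset (Fin d)} (hS : IsTopSet n α S)
    (h : l0Norm α ≤ n) : truncTo S α = α := by
  funext j
  by_cases hj : j ∈ S
  · simp [truncTo, hj]
  rw [truncTo, if_neg hj]
  by_contra h0
  have h1 : (insert j S : Set (Fin d)) ⊆ {i | α i ≠ 0} := by
    rintro i (rfl | hi)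
    · exact fun h => h0 h.symm
    · intro hi0
      have := hS.2 i hi j hj
      rw [hi0, abs_zero] at this
      exact h0 (abs_nonpos_iff.mp this).symm
  have h2 := Set.ncard_le_ncard h1 (Set.toFinite _)
  rw [Set.ncard_insert_of_notMem (by simpa using hj), Set.ncard_coe_finset, hS.1] at h2
  unfold l0Norm at h
  omega

theorem isParsimonious_one_of_l0Norm_le {A : Matrix (Fin n) (Fin d) ℝ}
    {op : (Fin n → ℝ) → Fin d → ℝ} (hop : ∀ Y, A *ᵥ op Y = Y) (h : ∀ Y, l0Norm (op Y) ≤ n) :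
    IsParsimonious A 1 op :=
  ⟨hop, fun Y S hS => by rw [truncTo_eq_self_of_l0Norm_le hS (h Y), hop, one_mul]⟩

theorem exists_isBPOperator_isParsimonious {A : Matrix (Fin n) (Fin d) ℝ} (hA : A.rank = n) :
    ∃ op, IsBPOperator A op ∧ (∀ Y, l0Norm (op Y) ≤ n) ∧ IsParsimonious A 1 op := by
  choose op hop using fun Y =>
    exists_isMinL1Interpolator_linearIndepOn (mulVec_surjective_of_rank_eq hA Y)
  have h : ∀ Y, l0Norm (op Y) ≤ n := fun Y => l0Norm_le_of_forall_ker (hop Y).2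
  exact ⟨op, fun Y => (hop Y).1, h, isParsimonious_one_of_l0Norm_le (fun Y => (hop Y).1.1) h⟩

/-- Equality must hold in the triangle inequality at every coordinate, so nothing cancels and the
midpoint carries both supports. This lets one dual vector serve two solutions. -/
theorem IsMinL1Interpolator.midpoint {A : Matrix (Fin n) (Fin d) ℝ} {Y : Fin n → ℝ}
    {α β : Fin d → ℝ} (hα : IsMinL1Interpolator A Y α) (hβ : IsMinL1Interpolator A Y β) :
    IsMinL1Interpolator A Y ((1 / 2 : ℝ) • (α + β)) ∧
      ∀ i, ((1 / 2 : ℝ) • (α + β)) i = 0 → α i = 0 ∧ β i = 0 := by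
  have hγ : A *ᵥ ((1 / 2 : ℝ) • (α + β)) = Y := by
    rw [Matrix.mulVec_smul, Matrix.mulVec_add, hα.1, hβ.1]
    funext i
    simp only [Pi.smul_apply, Pi.add_apply, smul_eq_mul]
    ring
  have habs : ∀ i, |((1 / 2 : ℝ) • (α + β)) i| ≤ (|α i| + |β i|) / 2 := fun i => by
    simp only [Pi.smul_apply, Pi.add_apply, smul_eq_mul]
    grind
  have hle : l1Norm ((1 / 2 : ℝ) • (α + β)) ≤ (l1Norm α + l1Norm β) / 2 := by
    unfold l1Norm
    rw [← Finset.sum_add_distrib, Finset.sum_div]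
    exact Finset.sum_le_sum fun i _ => habs i
  have h1 := hα.2 β hβ.1
  have h2 := hβ.2 α hα.1
  have h3 := hα.2 _ hγ
  refine ⟨⟨hγ, fun α' h' => ?_⟩, fun i hi => ?_⟩
  · have := hα.2 _ h'
    linarith
  · have heq : ∑ i, |((1 / 2 : ℝ) • (α + β)) i| = ∑ i, (|α i| + |β i|) / 2 := by
      rw [← Finset.sum_div, Finset.sum_add_distrib]
      unfold l1Norm at hle h3 h1 h2
      linarith
    have := (Finset.sum_eq_sum_iff_of_le fun i _ => habs i).mp heq i (Finset.mem_univ i)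
    rw [hi, abs_zero] at this
    have h4 := abs_nonneg (α i)
    have h5 := abs_nonneg (β i)
    constructor <;> apply abs_eq_zero.mp <;> linarith

/-- The sign pattern of a basis pursuit solution is orthogonal to the kernel directions supported in
its support. -/
theorem IsMinL1Interpolator.sum_sign_mul_eq_zero {A : Matrix (Fin n) (Fin d) ℝ} {Y : Fin n → ℝ}
    {α z : Fin d → ℝ} (hα : IsMinL1Interpolator A Y α) (hz : A *ᵥ z = 0)
    (hsupp : ∀ i, α i = 0 → z i = 0) : ∑ i, SignType.sign (α i) * z i = 0 := by
  classical
  -- For small `ε` the signs on the support do not change, so the `ℓ¹` norm is linear in the step;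
  -- minimality in both directions makes the slope zero.
  obtain ⟨ε, hε, hbound⟩ : ∃ ε : ℝ, 0 < ε ∧ ∀ i, |ε * z i| ≤ |α i| := by
    have : ∀ i, ∀ᶠ ε in nhdsWithin (0 : ℝ) (Set.Ioi 0), |ε * z i| ≤ |α i| := by
      intro i
      by_cases hi : α i = 0
      · simp [hi, hsupp i hi]
      · have hc : Filter.Tendsto (fun ε : ℝ => |ε * z i|) (nhdsWithin 0 (Set.Ioi 0)) (nhds 0) := by
          have : Continuous fun ε : ℝ => |ε * z i| := by fun_prop
          simpa using (this.tendsto 0).mono_left nhdsWithin_le_nhds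
        exact hc.eventually_le_const (abs_pos.mpr hi)
    obtain ⟨ε, h1, h2⟩ := ((Filter.eventually_all.mpr this).and self_mem_nhdsWithin).exists
    exact ⟨ε, h2, h1⟩
  have key : ∀ s : ℝ, |s| = 1 →
      l1Norm (α + (s * ε) • z) = l1Norm α + s * ε * ∑ i, SignType.sign (α i) * z i := by
    intro s hs
    unfold l1Norm
    rw [Finset.mul_sum, ← Finset.sum_add_distrib]
    refine Finset.sum_congr rfl fun i _ => ?_
    have h1 : |s * ε * z i| ≤ |α i| := by rw [mul_assoc, abs_mul, hs, one_mul]; exact hbound i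
    have h2 : (α + (s * ε) • z) i = α i + s * ε * z i := rfl
    rw [h2]
    rcases lt_trichotomy (α i) 0 with h | h | h
    · rw [sign_neg h, abs_of_neg h, abs_of_nonpos]
      · simp; ring
      · rw [abs_of_neg h] at h1
        linarith [le_abs_self (s * ε * z i)]
    · simp [h, hsupp i h]
    · rw [sign_pos h, abs_of_pos h, abs_of_nonneg]
      · simp
      · rw [abs_of_pos h] at h1
        linarith [neg_abs_le (s * ε * z i)]
  have hfeas : ∀ s : ℝ, l1Norm α ≤ l1Norm (α + s • z) := fun s =>
    hα.2 _ (by rw [Matrix.mulVec_add, Matrix.mulVec_smul, hz, hα.1, smul_zero, add_zero])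
  have h1 := hfeas (1 * ε)
  have h2 := hfeas (-1 * ε)
  rw [key _ (by simp)] at h1 h2
  have h3 : ε * ∑ i, SignType.sign (α i) * z i = 0 := by linarith
  exact (mul_eq_zero.mp h3).resolve_left hε.ne'

/-- Restricted to the support, the sign functional vanishes on the common kernel of the rows of `A`,
hence is a combination of these rows; the coefficients are `y`. -/
theorem IsMinL1Interpolator.exists_dual {A : Matrix (Fin n) (Fin d) ℝ} {Y : Fin n → ℝ}
    {α : Fin d → ℝ} (hα : IsMinL1Interpolator A Y α) :
    ∃ y : Fin n → ℝ, ∀ i, α i ≠ 0 → |(y ᵥ* A) i| = 1 := by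
  classical
  -- Functionals on the coordinate subspace indexed by the support.
  let E : ({i // α i ≠ 0} → ℝ) →ₗ[ℝ] (Fin d → ℝ) :=
    Function.ExtendByZero.linearMap ℝ ((↑) : {i // α i ≠ 0} → Fin d)
  have hE : ∀ x, ∀ i : {i // α i ≠ 0}, E x i = x i := fun x i =>
    Subtype.val_injective.extend_apply x 0 i
  have hE0 : ∀ x, ∀ i, α i = 0 → E x i = 0 := fun x i hi =>
    Function.extend_apply' _ _ _ (by rintro ⟨a, rfl⟩; exact a.2 hi)
  let L : Fin n → (({i // α i ≠ 0} → ℝ) →ₗ[ℝ] ℝ) := fun k =>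
    LinearMap.proj k ∘ₗ A.mulVecLin ∘ₗ E
  let K : (Fin d → ℝ) →ₗ[ℝ] ℝ := ∑ i, (SignType.sign (α i) : ℝ) • LinearMap.proj i
  have hK : ∀ x, K x = ∑ i, SignType.sign (α i) * x i := fun x => by
    simp [K, LinearMap.sum_apply]
  have hmem : K ∘ₗ E ∈ Submodule.span ℝ (Set.range L) := by
    refine mem_span_of_iInf_ker_le_ker fun x hx => ?_
    rw [LinearMap.mem_ker, LinearMap.comp_apply, hK]
    refine hα.sum_sign_mul_eq_zero ?_ (hE0 x)
    funext k
    exact LinearMap.mem_ker.mp ((Submodule.mem_iInf _).mp hx k)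
  obtain ⟨y, hy⟩ := (Submodule.mem_span_range_iff_exists_fun ℝ).mp hmem
  refine ⟨y, fun i hi => ?_⟩
  have h1 := LinearMap.congr_fun hy (Pi.single ⟨i, hi⟩ 1)
  have h2 : E (Pi.single ⟨i, hi⟩ 1) = Pi.single i 1 := by
    funext j
    by_cases hj : α j = 0
    · rw [hE0 _ j hj, Pi.single_eq_of_ne]
      rintro rfl; exact hi hj
    · rw [hE _ ⟨j, hj⟩]
      by_cases hij : j = i
      · subst hij; simp
      · rw [Pi.single_eq_of_ne hij, Pi.single_eq_of_ne]
        simpa using hij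
  have h3 : (y ᵥ* A) i = SignType.sign (α i) := by
    rw [LinearMap.comp_apply, hK, h2] at h1
    simp only [L, LinearMap.sum_apply, LinearMap.smul_apply, LinearMap.comp_apply, h2] at h1
    simpa [Pi.single_apply, Matrix.vecMul, dotProduct] using h1
  rw [h3]
  rcases lt_or_gt_of_ne hi with h | h
  · simp [sign_neg h]
  · simp [sign_pos h]

/-! ### Non-degenerate data matrices -/

/-- If `s` has at most `n ≤ d` elements then it is contained in the range of an embedding of
`Fin n`. -/
theorem exists_embedding_range_superset (h : n ≤ d) {s : Set (Fin d)} (hs : s.ncard ≤ n) :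
    ∃ e : Fin n ↪ Fin d, s ⊆ Set.range e := by
  classical
  obtain ⟨t, hst, -, ht⟩ := Set.exists_superset_subset_encard_eq (s := s) (t := Set.univ) (k := n)
    (Set.subset_univ _) (by rw [← Set.Finite.cast_ncard_eq (Set.toFinite s)]; exact_mod_cast hs)
    (by simpa [Set.encard_univ] using h)
  have hcard : t.ncard = n := by simp [Set.ncard, ht]
  have := Fintype.ofFinite t
  have hcard' : Fintype.card t = n := by
    rw [← Nat.card_eq_fintype_card, Nat.card_coe_set_eq, hcard]
  let f := (Fintype.equivFinOfCardEq hcard').symm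
  exact ⟨f.toEmbedding.trans (Function.Embedding.subtype _), fun i hi =>
    ⟨f.symm ⟨i, hst hi⟩, by simp⟩⟩

theorem mulVec_eq_submatrix_mulVec {A : Matrix (Fin n) (Fin d) ℝ} {e : Fin n ↪ Fin d}
    {x : Fin d → ℝ} (hx : ∀ i, i ∉ Set.range e → x i = 0) :
    A *ᵥ x = A.submatrix id e *ᵥ (x ∘ e) := by
  funext k
  simp only [Matrix.mulVec, dotProduct, Matrix.submatrix_apply, Function.comp, id]
  rw [← Finset.sum_map Finset.univ e fun i => A k i * x i]
  refine (Finset.sum_subset (Finset.subset_univ _) fun i _ hi => ?_).symm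
  rw [hx i (by simpa using hi), mul_zero]

theorem IsNondegenerate.eq_zero_of_mulVec_eq_zero {A : Matrix (Fin n) (Fin d) ℝ}
    (hA : IsNondegenerate A) {e : Fin n ↪ Fin d} {x : Fin d → ℝ}
    (hx : ∀ i, i ∉ Set.range e → x i = 0) (h : A *ᵥ x = 0) : x = 0 := by
  rw [mulVec_eq_submatrix_mulVec hx] at h
  have h0 : x ∘ e = 0 := Matrix.mulVec_injective_iff_isUnit.mpr (hA.1 e) (by simpa using h)
  funext i
  by_cases hi : i ∈ Set.range e
  · obtain ⟨k, rfl⟩ := hi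
    exact congrFun h0 k
  · exact hx i hi

theorem IsNondegenerate.rank_eq {A : Matrix (Fin n) (Fin d) ℝ} (hA : IsNondegenerate A)
    (hnd : n ≤ d) : A.rank = n := by
  refine le_antisymm (A.rank_le_card_height.trans_eq (Fintype.card_fin n)) ?_
  have h := Matrix.rank_of_isUnit _ (hA.1 (Fin.castLEEmb hnd))
  have h2 := A.rank_submatrix_le id (Fin.castLEEmb hnd)
  rw [h, Fintype.card_fin] at h2
  exact h2

/-- The dual vector of the midpoint of two solutions has modulus one on at most `n` columns. Both
solutions live on these, and the columns are independent. -/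
theorem IsNondegenerate.existsUnique {A : Matrix (Fin n) (Fin d) ℝ} (hA : IsNondegenerate A)
    (hnd : n ≤ d) (Y : Fin n → ℝ) : ∃! α, IsMinL1Interpolator A Y α := by
  obtain ⟨α, hα⟩ := exists_isMinL1Interpolator (mulVec_surjective_of_rank_eq (hA.rank_eq hnd) Y)
  refine ⟨α, hα, fun β hβ => ?_⟩
  obtain ⟨hγ, hsupp⟩ := hβ.midpoint hα
  obtain ⟨y, hy⟩ := hγ.exists_dual
  obtain ⟨e, he⟩ := exists_embedding_range_superset hnd (hA.2 y)
  refine sub_eq_zero.mp (hA.eq_zero_of_mulVec_eq_zero (e := e) (fun i hi => ?_) ?_)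
  · have h := hsupp i (not_not.mp fun h => hi (he (hy i h)))
    rw [Pi.sub_apply, h.1, h.2, sub_zero]
  · rw [Matrix.mulVec_sub, hα.1, hβ.1, sub_self]

theorem IsNondegenerate.l0Norm_le {A : Matrix (Fin n) (Fin d) ℝ} (hA : IsNondegenerate A)
    (hnd : n ≤ d) {Y : Fin n → ℝ} {α : Fin d → ℝ} (hα : IsMinL1Interpolator A Y α) :
    l0Norm α ≤ n := by
  obtain ⟨op, hop, hle, -⟩ := exists_isBPOperator_isParsimonious (hA.rank_eq hnd)
  rw [(hA.existsUnique hnd Y).unique hα (hop Y)]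
  exact hle Y

theorem IsNondegenerate.isParsimonious {A : Matrix (Fin n) (Fin d) ℝ} (hA : IsNondegenerate A)
    (hnd : n ≤ d) {op : (Fin n → ℝ) → Fin d → ℝ} (hop : IsBPOperator A op) :
    IsParsimonious A 1 op :=
  isParsimonious_one_of_l0Norm_le (fun Y => (hop Y).1) fun Y => hA.l0Norm_le hnd (hop Y)

/-- If the support of a solution has fewer than `n` elements, then some maximal minor of
`A` vanishes once one of its columns is replaced by the output. -/
theorem exists_cramer_eq_zero_of_l0Norm_lt {A : Matrix (Fin n) (Fin d) ℝ}
    (hnd : n ≤ d) {Y : Fin n → ℝ} {α : Fin d → ℝ} (hY : A *ᵥ α = Y) (hα : l0Norm α < n) :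
    ∃ (e : Fin n ↪ Fin d) (i : Fin n), (A.submatrix id e).cramer Y i = 0 := by
  obtain ⟨e, he⟩ := exists_embedding_range_superset hnd hα.le
  have hx : ∀ i, i ∉ Set.range e → α i = 0 := fun i hi => not_not.mp fun h => hi (he h)
  obtain ⟨i, hi⟩ : ∃ i, α (e i) = 0 := by
    by_contra! hne
    have h1 : Set.range e ⊆ {i | α i ≠ 0} := by rintro _ ⟨i, rfl⟩; exact hne i
    have h2 := Set.ncard_le_ncard h1 (Set.toFinite _)
    rw [← Set.image_univ, Set.ncard_image_of_injective _ e.injective, Set.ncard_univ] at h2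
    rw [Nat.card_eq_fintype_card, Fintype.card_fin] at h2
    exact absurd hα h2.not_gt
  refine ⟨e, i, ?_⟩
  -- Cramer's vector at `M x` is `det M • x`, and coordinate `i` of `x` is zero.
  rw [← hY, mulVec_eq_submatrix_mulVec hx, Matrix.cramer_eq_adjugate_mulVec, Matrix.mulVec_mulVec,
    Matrix.adjugate_mul, Matrix.smul_mulVec, Matrix.one_mulVec]
  simp [hi]

end BasisPursuit

/-! ### Genericity -/

section Genericity

/-- Every nonzero affine functional is almost everywhere nonzero. -/
def ChargesNoHyperplane {E : Type*} [AddCommGroup E] [Module ℝ E] [MeasurableSpace E]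
    (μ : Measure E) : Prop :=
  ∀ f : E →ᵃ[ℝ] ℝ, (∃ x, f x ≠ 0) → ∀ᵐ x ∂μ, f x ≠ 0

/-- The zero set is a proper affine subspace, which is null for Haar measure. -/
theorem ChargesNoHyperplane.of_absolutelyContinuous {E : Type*} [NormedAddCommGroup E]
    [NormedSpace ℝ E] [MeasurableSpace E] [BorelSpace E] [FiniteDimensional ℝ E]
    {μ ν : Measure E} [ν.IsAddHaarMeasure] (h : μ ≪ ν) : ChargesNoHyperplane μ := by
  rintro f ⟨x, hx⟩
  refine h.ae_le ?_
  have h0 := Measure.addHaar_affineSubspace ν ((AffineSubspace.mk' (0 : ℝ) ⊥).comap f) (by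
    intro htop
    have : x ∈ (AffineSubspace.mk' (0 : ℝ) ⊥).comap f := htop ▸ AffineSubspace.mem_top ℝ E x
    rw [AffineSubspace.mem_comap, AffineSubspace.mem_mk'] at this
    simp [hx] at this)
  refine ae_iff.mpr ?_
  convert h0 using 2
  ext y
  simp [AffineSubspace.mem_mk']

/-- A function of finitely many independent variables that is affine in each of them and does not
vanish identically is almost surely nonzero. -/
theorem ChargesNoHyperplane.ae_ne_zero_of_forall_affine {E : Type*} [AddCommGroup E] [Module ℝ E]
    [MeasurableSpace E] {μ : Measure E} [SigmaFinite μ] (hμ : ChargesNoHyperplane μ) {n : ℕ}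
    {F : (Fin n → E) → ℝ} (hF : Measurable F)
    (haff : ∀ A i, ∃ g : E →ᵃ[ℝ] ℝ, ∀ x, F (Function.update A i x) = g x)
    (hne : ∃ A, F A ≠ 0) : ∀ᵐ A ∂(Measure.pi fun _ : Fin n => μ), F A ≠ 0 := by
  induction n with
  | zero =>
    obtain ⟨A, hA⟩ := hne
    exact Filter.Eventually.of_forall fun B => by rwa [Subsingleton.elim B A]
  | succ n ih =>
    obtain ⟨A, hA⟩ := hne
    have hmp := measurePreserving_piFinSuccAbove (fun _ : Fin (n + 1) => μ) 0
    set e := MeasurableEquiv.piFinSuccAbove (fun _ : Fin (n + 1) => E) 0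
    have he : ∀ x B, e.symm (x, B) = Fin.cons x B := fun x B => by
      simp [e, Fin.insertNthEquiv]
    have hms : MeasurableSet {z : E × (Fin n → E) | F (e.symm z) ≠ 0} :=
      (hF.comp e.symm.measurable) (measurableSet_singleton (0 : ℝ)).compl
    have hmain : ∀ᵐ z ∂(μ.prod (Measure.pi fun _ : Fin n => μ)), F (e.symm z) ≠ 0 := by
      rw [Measure.ae_prod_iff_ae_ae hms]
      obtain ⟨g, hg⟩ := haff A 0
      -- With the other variables frozen at the witness, almost every first variable leaves a
      -- section that is still not identically zero; induction applies to that section.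
      have h1 : ∀ x, g x = F (Fin.cons x (Fin.tail A)) := fun x => by
        rw [← hg, ← Fin.cons_self_tail A, Fin.update_cons_zero, Fin.tail_cons]
      filter_upwards [hμ g ⟨A 0, by rwa [h1, Fin.cons_self_tail]⟩] with x hx
      simp_rw [he]
      refine ih (F := fun B => F (Fin.cons x B)) ?_ (fun B i => ?_) ⟨Fin.tail A, by rwa [← h1]⟩
      · refine hF.comp (measurable_pi_lambda _ fun i => ?_)
        refine Fin.cases ?_ (fun j => ?_) i
        · simp
        · simpa using measurable_pi_apply j
      · obtain ⟨g, hg⟩ := haff (Fin.cons x B) i.succ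
        exact ⟨g, fun y => by rw [← hg, Fin.cons_update]⟩
    filter_upwards [hmp.quasiMeasurePreserving.ae hmain] with B hB
    simpa using hB

theorem ChargesNoHyperplane.pi {μ : Measure ℝ} [SigmaFinite μ] (hμ : ChargesNoHyperplane μ)
    (n : ℕ) : ChargesNoHyperplane (Measure.pi fun _ : Fin n => μ) := by
  intro f hf
  refine hμ.ae_ne_zero_of_forall_affine f.continuous_of_finiteDimensional.measurable
    (fun A i => ⟨f.comp ((LinearMap.single ℝ (fun _ => ℝ) i).toAffineMap +
      AffineMap.const ℝ ℝ (Function.update A i 0)), fun x => ?_⟩) hf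
  rw [AffineMap.comp_apply]
  congr 1
  funext j
  by_cases hj : j = i
  · subst hj; simp
  · simp [hj]

theorem chargesNoHyperplane_gaussianReal (m : ℝ) {v : NNReal} (hv : v ≠ 0) :
    ChargesNoHyperplane (gaussianReal m v) :=
  .of_absolutelyContinuous (gaussianReal_absolutelyContinuous m hv)

instance (σ : ℝ) : IsProbabilityMeasure (noiseLaw σ) :=
  instIsProbabilityMeasureGaussianReal 0 _

instance (n : ℕ) (σ : ℝ) : IsProbabilityMeasure (trainNoise n σ) := by
  unfold trainNoise; infer_instance

instance (d : ℕ) : IsProbabilityMeasure (gaussianFeatures d) := by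
  unfold gaussianFeatures; infer_instance

instance {d : ℕ} (P : Measure (Fin d → ℝ)) [IsProbabilityMeasure P] (n : ℕ) :
    IsProbabilityMeasure (trainFeatures P n) := by
  unfold trainFeatures; infer_instance

instance {d : ℕ} (P : Measure (Fin d → ℝ)) [IsProbabilityMeasure P] (n : ℕ) (σ : ℝ) :
    IsProbabilityMeasure (trainLaw P n σ) := by
  unfold trainLaw; infer_instance

theorem chargesNoHyperplane_trainNoise (n : ℕ) {σ : ℝ} (hσ : 0 < σ) :
    ChargesNoHyperplane (trainNoise n σ) := by
  refine ChargesNoHyperplane.pi (chargesNoHyperplane_gaussianReal 0 fun h => ?_) n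
  have := congrArg NNReal.toReal h
  exact (pow_pos hσ 2).ne' this

theorem chargesNoHyperplane_gaussianFeatures (d : ℕ) : ChargesNoHyperplane (gaussianFeatures d) :=
  ChargesNoHyperplane.pi (chargesNoHyperplane_gaussianReal 0 one_ne_zero) d

variable {n d : ℕ}

/-- The determinant is linear in each row, and equals one when the chosen columns form the identity.
-/
theorem ChargesNoHyperplane.ae_det_submatrix_ne_zero {P : Measure (Fin d → ℝ)} [SigmaFinite P]
    (hP : ChargesNoHyperplane P) (e : Fin n ↪ Fin d) :
    ∀ᵐ A ∂(trainFeatures P n), ((Matrix.of A).submatrix id e).det ≠ 0 := by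
  classical
  refine hP.ae_ne_zero_of_forall_affine (F := fun A => ((Matrix.of A).submatrix id e).det)
    ?_ (fun A i => ⟨((Matrix.detRowAlternating (R := ℝ)).toMultilinearMap.toLinearMap
      ((Matrix.of A).submatrix id e) i ∘ₗ LinearMap.funLeft ℝ ℝ e).toAffineMap, fun x => ?_⟩)
    ⟨fun k j => if e k = j then 1 else 0, ?_⟩
  · refine Continuous.measurable (Continuous.matrix_det ?_)
    exact continuous_pi fun i => continuous_pi fun j => by
      simp only [Matrix.submatrix_apply, Matrix.of_apply]; fun_prop
  · have h : (fun k j => Function.update A i x k (e j)) =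
        Function.update (fun k j => A k (e j)) i fun j => x (e j) := by
      funext k j
      by_cases hk : k = i
      · subst hk; simp
      · simp [hk]
    exact congrArg (fun M : Fin n → Fin n → ℝ => Matrix.det (Matrix.of M)) h
  · convert one_ne_zero (α := ℝ)
    convert Matrix.det_one (n := Fin n) (R := ℝ)
    ext k j
    simp [Matrix.one_apply]

/-- With `s` a sign vector this excludes `n + 1` columns on one hyperplane up to sign: if `⟨y, A_j⟩
= s_j` for all of them, `(-1, y)` is a left null vector. The determinant is not identically zero:
put the identity in the columns other than some `j₀` with `s j₀ ≠ 0`. -/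
theorem ChargesNoHyperplane.ae_det_cons_ne_zero {P : Measure (Fin d → ℝ)} [SigmaFinite P]
    (hP : ChargesNoHyperplane P) (e : Fin (n + 1) ↪ Fin d) {s : Fin (n + 1) → ℝ} (hs : s ≠ 0) :
    ∀ᵐ A ∂(trainFeatures P n),
      (Matrix.of (Fin.cons s fun k j => A k (e j) : Fin (n + 1) → Fin (n + 1) → ℝ)).det ≠ 0 := by
  classical
  obtain ⟨j₀, hj₀⟩ := Function.ne_iff.mp hs
  refine hP.ae_ne_zero_of_forall_affine
    (F := fun A => (Matrix.of (Fin.cons s fun k j => A k (e j) : Fin (n + 1) → _ → ℝ)).det)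
    ?_ (fun A i => ⟨((Matrix.detRowAlternating (R := ℝ)).toMultilinearMap.toLinearMap
      (Fin.cons s fun k j => A k (e j) : Fin (n + 1) → Fin (n + 1) → ℝ) i.succ ∘ₗ
        LinearMap.funLeft ℝ ℝ e).toAffineMap, fun x => ?_⟩)
    ⟨fun k j => if e (j₀.succAbove k) = j then 1 else 0, ?_⟩
  · refine Continuous.measurable (Continuous.matrix_det ?_)
    refine continuous_pi fun i => continuous_pi fun j => ?_
    refine Fin.cases ?_ (fun k => ?_) i
    · simpa using continuous_const
    · simp only [Matrix.of_apply, Fin.cons_succ]; fun_prop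
  · simp only [LinearMap.coe_toAffineMap, LinearMap.comp_apply, MultilinearMap.toLinearMap_apply]
    change _ = Matrix.det _
    congr 1
    ext k j
    refine Fin.cases ?_ (fun k => ?_) k
    · simp [Function.update_of_ne (Fin.succ_ne_zero i).symm]
    · by_cases hk : k = i
      · subst hk; simp [LinearMap.funLeft_apply]
      · simp [hk]
  · intro hdet
    obtain ⟨v, hv, h0⟩ := Matrix.exists_mulVec_eq_zero_iff.mpr hdet
    have h1 : ∀ k, v (j₀.succAbove k) = 0 := fun k => by
      simpa [Matrix.mulVec, dotProduct] using congrFun h0 k.succ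
    have h2 := congrFun h0 0
    simp only [Matrix.mulVec, dotProduct, Matrix.of_apply, Fin.cons_zero] at h2
    rw [Fin.sum_univ_succAbove _ j₀] at h2
    simp only [h1, mul_zero, Finset.sum_const_zero, add_zero, Pi.zero_apply] at h2
    refine hv (funext fun j => ?_)
    rcases Fin.eq_self_or_eq_succAbove j₀ j with rfl | ⟨k, rfl⟩
    · exact (mul_eq_zero.mp h2).resolve_left hj₀
    · exact h1 k

theorem ChargesNoHyperplane.ae_isNondegenerate {P : Measure (Fin d → ℝ)} [SigmaFinite P]
    (hP : ChargesNoHyperplane P) : ∀ᵐ A ∂(trainFeatures P n), IsNondegenerate (Matrix.of A) := by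
  classical
  have h1 := ae_all_iff.mpr fun e : Fin n ↪ Fin d => hP.ae_det_submatrix_ne_zero e
  have h2 := ae_all_iff.mpr fun e : Fin (n + 1) ↪ Fin d =>
    ae_all_iff.mpr fun s : Fin (n + 1) → Bool =>
      hP.ae_det_cons_ne_zero e (s := fun j => if s j then 1 else -1)
        (Function.ne_iff.mpr ⟨0, by simp only [Pi.zero_apply]; split_ifs <;> norm_num⟩)
  filter_upwards [h1, h2] with A hA1 hA2
  refine ⟨fun e => (Matrix.isUnit_iff_isUnit_det _).mpr (isUnit_iff_ne_zero.mpr (hA1 e)),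
    fun y => ?_⟩
  by_contra! hlt
  rw [Set.ncard_eq_toFinset_card _ (Set.toFinite _)] at hlt
  obtain ⟨t, hts, htc⟩ := Finset.exists_subset_card_eq (Nat.succ_le_of_lt hlt)
  have ht : ∀ i ∈ t, |(y ᵥ* Matrix.of A) i| = 1 := fun i hi => by simpa using hts hi
  let e := (t.orderEmbOfFin htc).toEmbedding
  refine hA2 e (fun j => decide ((y ᵥ* Matrix.of A) (e j) = 1)) ?_
  refine Matrix.exists_vecMul_eq_zero_iff.mp ⟨Fin.cons (-1) y, fun h => ?_, ?_⟩
  · simpa using congrFun h 0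
  · funext j
    have hj := ht (e j) (t.orderEmbOfFin_mem htc j)
    have hsplit : ∀ s : Fin (n + 1) → ℝ,
        ((Fin.cons (-1) y : Fin (n + 1) → ℝ) ᵥ*
          Matrix.of (Fin.cons s fun k j => A k (e j) : Fin (n + 1) → Fin (n + 1) → ℝ)) j =
        -s j + (y ᵥ* Matrix.of A) (e j) := fun s => by
      simp [Matrix.vecMul, dotProduct, Fin.sum_univ_succ]
    rw [hsplit, Pi.zero_apply]
    rcases (abs_eq zero_le_one).mp hj with h | h <;> simp only [h] <;> norm_num

theorem IsNondegenerate.ae_cramer_ne_zero {A : Matrix (Fin n) (Fin d) ℝ} (hA : IsNondegenerate A)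
    {μ : Measure (Fin n → ℝ)} (hμ : ChargesNoHyperplane μ) (Y : Fin n → ℝ) :
    ∀ᵐ w ∂μ, ∀ (e : Fin n ↪ Fin d) (i : Fin n), (A.submatrix id e).cramer (Y + w) i ≠ 0 := by
  refine ae_all_iff.mpr fun e => ae_all_iff.mpr fun i => ?_
  let f : (Fin n → ℝ) →ᵃ[ℝ] ℝ :=
    (LinearMap.proj i ∘ₗ (A.submatrix id e).cramer).toAffineMap.comp
      (AffineMap.const ℝ (Fin n → ℝ) Y + (AffineMap.id ℝ (Fin n → ℝ)))
  -- This point moves the output to the `i`-th chosen column, where the Cramer coordinate is the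
  -- nonzero minor itself.
  refine hμ f ⟨A.submatrix id e *ᵥ Pi.single i 1 - Y, ?_⟩
  have : f (A.submatrix id e *ᵥ Pi.single i 1 - Y) =
      (A.submatrix id e).cramer (A.submatrix id e *ᵥ Pi.single i 1) i := by
    simp [f]
  rw [this, Matrix.cramer_eq_adjugate_mulVec, Matrix.mulVec_mulVec, Matrix.adjugate_mul,
    Matrix.smul_mulVec, Matrix.one_mulVec]
  simpa using ((Matrix.isUnit_iff_isUnit_det _).mp (hA.1 e)).ne_zero

theorem IsNondegenerate.ae_l0Norm_eq {A : Matrix (Fin n) (Fin d) ℝ} (hA : IsNondegenerate A)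
    (hnd : n ≤ d) {σ : ℝ} (hσ : 0 < σ) (αstar : Fin d → ℝ) : ∀ᵐ w ∂(trainNoise n σ),
      ∀ α, IsMinL1Interpolator A (outputs A αstar w) α → l0Norm α = n := by
  filter_upwards [hA.ae_cramer_ne_zero (chargesNoHyperplane_trainNoise n hσ) (A *ᵥ αstar)]
    with w hw α hα
  refine (hA.l0Norm_le hnd hα).antisymm (not_lt.mp fun hlt => ?_)
  obtain ⟨e, i, h⟩ := exists_cramer_eq_zero_of_l0Norm_lt hnd hα.1 hlt
  exact hw e i h

/-- Full support under the joint law is phrased by Cramer minors because these define an open, hence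
measurable, set, as Fubini requires. -/
theorem ae_trainLaw_cramer_ne_zero {P : Measure (Fin d → ℝ)} [IsProbabilityMeasure P]
    (hP : ∀ᵐ A ∂(trainFeatures P n), IsNondegenerate (Matrix.of A)) {σ : ℝ} (hσ : 0 < σ) :
    ∀ᵐ z ∂(trainLaw P n σ), ∀ (e : Fin n ↪ Fin d) (i : Fin n),
      ((Matrix.of z.1).submatrix id e).cramer z.2 i ≠ 0 := by
  have hms : MeasurableSet {z : (Fin n → Fin d → ℝ) × (Fin n → ℝ) |
      ∀ (e : Fin n ↪ Fin d) (i : Fin n), ((Matrix.of z.1).submatrix id e).cramer z.2 i ≠ 0} := by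
    simp only [Set.ofPred_forall]
    refine MeasurableSet.iInter fun e => MeasurableSet.iInter fun i => ?_
    refine (IsOpen.measurableSet ?_)
    refine isOpen_ne_fun ?_ continuous_const
    simp only [Matrix.cramer_apply]
    refine Continuous.matrix_det (Continuous.matrix_updateCol i ?_ continuous_snd)
    exact continuous_pi fun i => continuous_pi fun j => by
      simp only [Matrix.submatrix_apply, Matrix.of_apply]; fun_prop
  unfold trainLaw
  rw [Measure.ae_prod_iff_ae_ae hms]
  filter_upwards [hP] with A hA
  simpa using hA.ae_cramer_ne_zero (chargesNoHyperplane_trainNoise n hσ) 0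

end Genericity

/-! ### Exponential moments -/

section ExponentialMoments

theorem sqNorm_eq_dotProduct {ι : Type*} [Fintype ι] (v : ι → ℝ) : sqNorm v = v ⬝ᵥ v := by
  simp [sqNorm, dotProduct, sq]

theorem sqNorm_smul {ι : Type*} [Fintype ι] (t : ℝ) (v : ι → ℝ) :
    sqNorm (t • v) = t ^ 2 * sqNorm v := by
  simp [sqNorm, mul_pow, Finset.mul_sum]

theorem sqNorm_pos {ι : Type*} [Fintype ι] {v : ι → ℝ} (hv : v ≠ 0) : 0 < sqNorm v := by
  rw [sqNorm_eq_dotProduct]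
  exact lt_of_le_of_ne (sqNorm_eq_dotProduct v ▸ sqNorm_nonneg v)
    fun h => hv (dotProduct_self_eq_zero.mp h.symm)

theorem measurable_sqNorm {ι : Type*} [Fintype ι] : Measurable (sqNorm : (ι → ℝ) → ℝ) := by
  unfold sqNorm; fun_prop

theorem measurable_dotProduct_const {ι : Type*} [Fintype ι] (v : ι → ℝ) :
    Measurable fun a : ι → ℝ => a ⬝ᵥ v := by
  unfold dotProduct; fun_prop

theorem lintegral_pi_prod {ι : Type*} [Fintype ι] {E : Type*} [MeasurableSpace E]
    {μ : Measure E} [IsProbabilityMeasure μ] {f : ι → E → ENNReal} (hf : ∀ i, Measurable (f i)) :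
    ∫⁻ x, ∏ i, f i (x i) ∂(Measure.pi fun _ : ι => μ) = ∏ i, ∫⁻ x, f i x ∂μ := by
  have h := iIndepFun_pi (μ := fun _ : ι => μ) (X := f) fun i => (hf i).aemeasurable
  rw [lintegral_prod_eq_prod_lintegral_of_indepFun Finset.univ _ h
    fun i => (hf i).comp (measurable_pi_apply i)]
  exact Finset.prod_congr rfl fun i _ =>
    (measurePreserving_eval (fun _ : ι => μ) i).lintegral_comp (hf i)

theorem lintegral_exp_mul_gaussianReal (t : ℝ) :
    ∫⁻ g, ENNReal.ofReal (Real.exp (t * g)) ∂(gaussianReal 0 1) =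
      ENNReal.ofReal (Real.exp (t ^ 2 / 2)) := by
  rw [← ofReal_integral_eq_lintegral_ofReal (integrable_exp_mul_gaussianReal t)
    (Filter.Eventually.of_forall fun _ => (Real.exp_pos _).le)]
  have := congrFun (mgf_fun_id_gaussianReal (μ := 0) (v := 1)) t
  simp only [mgf, zero_mul, zero_add, NNReal.coe_one, one_mul] at this
  rw [this]

theorem lintegral_exp_mul_sq_gaussianReal {b : ℝ} (hb : b < 1 / 2) :
    ∫⁻ g, ENNReal.ofReal (Real.exp (b * g ^ 2)) ∂(gaussianReal 0 1) =
      ENNReal.ofReal (√(1 - 2 * b))⁻¹ := by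
  rw [gaussianReal_of_var_ne_zero _ one_ne_zero,
    lintegral_withDensity_eq_lintegral_mul _ (measurable_gaussianPDF 0 1) (by fun_prop)]
  have h1 : ∀ x : ℝ, (gaussianPDF 0 1 * fun g => ENNReal.ofReal (Real.exp (b * g ^ 2))) x =
      ENNReal.ofReal ((√(2 * Real.pi))⁻¹ * Real.exp (-(1 / 2 - b) * x ^ 2)) := fun x => by
    rw [Pi.mul_apply, gaussianPDF_def, ← ENNReal.ofReal_mul (gaussianPDFReal_nonneg _ _ _),
      gaussianPDFReal_def]
    simp only [NNReal.coe_one, mul_one, sub_zero]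
    rw [mul_assoc, ← Real.exp_add]
    congr 3
    ring
  simp_rw [h1]
  rw [← ofReal_integral_eq_lintegral_ofReal
    ((integrable_exp_neg_mul_sq (by linarith)).const_mul _)
    (Filter.Eventually.of_forall fun _ => by positivity), integral_const_mul, integral_gaussian]
  congr 1
  rw [← Real.sqrt_inv, ← Real.sqrt_inv, ← Real.sqrt_mul (by positivity)]
  congr 1
  have h2 : 1 / 2 - b ≠ 0 := by linarith
  have h3 : 1 - 2 * b ≠ 0 := by linarith
  field_simp

/-- The squares of the one-dimensional marginals of `P` have a bounded exponential moment. -/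
def HasSqExpMoment {d : ℕ} (P : Measure (Fin d → ℝ)) (c : ℝ) : Prop :=
  ∀ v, sqNorm v ≤ 1 → ∫⁻ a, ENNReal.ofReal (Real.exp (c * (a ⬝ᵥ v) ^ 2)) ∂P ≤ 2

variable {n d : ℕ}

theorem lintegral_pow_le_of_isSubGaussianVar {Ω : Type*} [MeasurableSpace Ω] {μ : Measure Ω}
    {X : Ω → ℝ} {K : ℝ} (hK : 0 < K) (hX : IsSubGaussianVar μ X K) {k : ℕ} (hk : 1 ≤ k) :
    ∫⁻ ω, ENNReal.ofReal ((X ω ^ 2) ^ k) ∂μ ≤ ENNReal.ofReal ((2 * K ^ 2 * k) ^ k) := by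
  have hk' : (1 : ℝ) ≤ k := by exact_mod_cast hk
  have h1 := hX (2 * k) (by linarith)
  have hpos : (0 : ℝ) < 2 * k := by linarith
  rw [eLpNorm_eq_eLpNorm' (ENNReal.ofReal_pos.mpr hpos).ne' ENNReal.ofReal_ne_top,
    ENNReal.toReal_ofReal hpos.le] at h1
  have h2 := lintegral_rpow_enorm_eq_rpow_eLpNorm' (f := X) (μ := μ) hpos
  have h3 : ∀ ω, ENNReal.ofReal ((X ω ^ 2) ^ k) = ‖X ω‖ₑ ^ (2 * k : ℝ) := fun ω => by
    rw [← ofReal_norm, ENNReal.ofReal_rpow_of_nonneg (norm_nonneg _) hpos.le,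
      ← sq_abs, ← pow_mul, Real.norm_eq_abs]
    congr 1
    exact_mod_cast (Real.rpow_natCast |X ω| (2 * k)).symm
  simp_rw [h3]
  rw [h2]
  refine (ENNReal.rpow_le_rpow h1 hpos.le).trans_eq ?_
  rw [ENNReal.ofReal_rpow_of_nonneg (by positivity) hpos.le]
  congr 1
  have : (K * √(2 * k)) ^ (2 * k : ℝ) = (K * √(2 * k)) ^ (2 * k) := by
    exact_mod_cast Real.rpow_natCast (K * √(2 * k)) (2 * k)
  rw [this, pow_mul, mul_pow, Real.sq_sqrt hpos.le]
  ring

/-- Expand the exponential: the moments of order `2k` and `k^k / k! ≤ e^k` bound the `k`-th term by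
`2^(-k)`. -/
theorem lintegral_exp_sq_le_of_isSubGaussianVar {Ω : Type*} [MeasurableSpace Ω] {μ : Measure Ω}
    [IsProbabilityMeasure μ] {X : Ω → ℝ} (hXm : Measurable X) {K c : ℝ} (hK : 0 < K) (hc : 0 < c)
    (hcK : c * (2 * Real.exp 1 * K ^ 2) ≤ 1 / 2) (hX : IsSubGaussianVar μ X K) :
    ∫⁻ ω, ENNReal.ofReal (Real.exp (c * X ω ^ 2)) ∂μ ≤ 2 := by
  have h1 : ∀ ω, ENNReal.ofReal (Real.exp (c * X ω ^ 2)) =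
      ∑' k : ℕ, ENNReal.ofReal (c ^ k / k.factorial) * ENNReal.ofReal ((X ω ^ 2) ^ k) := fun ω => by
    rw [Real.exp_eq_exp_ℝ, NormedSpace.exp_eq_tsum_div,
      ENNReal.ofReal_tsum_of_nonneg (fun k => by positivity)
        (NormedSpace.expSeries_div_summable (c * X ω ^ 2))]
    refine tsum_congr fun k => ?_
    rw [← ENNReal.ofReal_mul (by positivity), mul_pow]
    congr 1
    ring
  simp_rw [h1]
  rw [lintegral_tsum fun k => by fun_prop]
  have h2 : ∀ k : ℕ,
      ∫⁻ ω, ENNReal.ofReal (c ^ k / k.factorial) * ENNReal.ofReal ((X ω ^ 2) ^ k) ∂μ ≤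
        ENNReal.ofReal ((1 / 2) ^ k) := fun k => by
    rw [lintegral_const_mul _ (by fun_prop)]
    rcases Nat.eq_zero_or_pos k with rfl | hk
    · simp
    refine (mul_le_mul_right (lintegral_pow_le_of_isSubGaussianVar hK hX hk) _).trans ?_
    rw [← ENNReal.ofReal_mul (by positivity)]
    refine ENNReal.ofReal_le_ofReal ?_
    have h3 : (k : ℝ) ^ k / k.factorial ≤ Real.exp 1 ^ k := by
      rw [← Real.exp_nat_mul, mul_one]
      exact Real.pow_div_factorial_le_exp _ (Nat.cast_nonneg k) k
    calc c ^ k / k.factorial * (2 * K ^ 2 * k) ^ k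
        = (c * (2 * K ^ 2)) ^ k * ((k : ℝ) ^ k / k.factorial) := by
          rw [mul_pow, mul_pow c]; ring
      _ ≤ (c * (2 * K ^ 2)) ^ k * Real.exp 1 ^ k := by gcongr
      _ = (c * (2 * Real.exp 1 * K ^ 2)) ^ k := by rw [← mul_pow]; ring
      _ ≤ (1 / 2) ^ k := by gcongr
  refine (ENNReal.tsum_le_tsum h2).trans_eq ?_
  rw [← ENNReal.ofReal_tsum_of_nonneg (fun k => by positivity) summable_geometric_two,
    tsum_geometric_two]
  simp

theorem IsSubGaussianVec.hasSqExpMoment {P : Measure (Fin d → ℝ)} [IsProbabilityMeasure P]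
    {K c : ℝ} (hK : 0 < K) (hc : 0 < c) (hcK : c * (2 * Real.exp 1 * K ^ 2) ≤ 1 / 2)
    (hP : IsSubGaussianVec P K) : HasSqExpMoment P c := by
  intro v hv
  refine (lintegral_mono fun a => ?_).trans (lintegral_exp_sq_le_of_isSubGaussianVar
    ((measurable_dotProduct_const v).div_const _) hK hc hcK (hP v))
  refine ENNReal.ofReal_le_ofReal (Real.exp_le_exp.mpr ?_)
  refine mul_le_mul_of_nonneg_left ?_ hc.le
  rw [div_pow, Real.sq_sqrt (sqNorm_nonneg v)]
  -- For `v = 0` the normalized marginal is `0 / 0 = 0`, so both exponents vanish.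
  by_cases h0 : v = 0
  · simp [h0]
  · exact le_div_self (sq_nonneg _) (sqNorm_pos h0) hv

/-- The constant is sharp on unit vectors: `𝔼 exp(3g²/8) = (1 - 3/4)^(-1/2) = 2`. The square is
linearized by an auxiliary Gaussian so that the coordinates factor. -/
theorem hasSqExpMoment_gaussianFeatures (d : ℕ) :
    HasSqExpMoment (gaussianFeatures d) (3 / 8) := by
  intro v hv
  have h1 : ∀ x : ℝ, ENNReal.ofReal (Real.exp (3 / 8 * x ^ 2)) =
      ∫⁻ g, ENNReal.ofReal (Real.exp (√(3 / 4) * x * g)) ∂(gaussianReal 0 1) := fun x => by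
    rw [lintegral_exp_mul_gaussianReal, mul_pow, Real.sq_sqrt (by norm_num)]
    congr 2; ring
  simp_rw [h1]
  rw [lintegral_lintegral_swap (by
    have := measurable_dotProduct_const v
    fun_prop)]
  have h2 : ∀ g : ℝ, ∫⁻ a, ENNReal.ofReal (Real.exp (√(3 / 4) * (a ⬝ᵥ v) * g))
      ∂(gaussianFeatures d) ≤ ENNReal.ofReal (Real.exp (3 / 8 * g ^ 2)) := fun g => by
    have h3 : ∀ a : Fin d → ℝ, ENNReal.ofReal (Real.exp (√(3 / 4) * (a ⬝ᵥ v) * g)) =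
        ∏ i, ENNReal.ofReal (Real.exp ((√(3 / 4) * g * v i) * a i)) := fun a => by
      rw [← ENNReal.ofReal_prod_of_nonneg fun _ _ => (Real.exp_pos _).le, ← Real.exp_sum]
      congr 2
      simp only [dotProduct, Finset.mul_sum, Finset.sum_mul]
      exact Finset.sum_congr rfl fun i _ => by ring
    simp_rw [h3]
    rw [gaussianFeatures, lintegral_pi_prod
      (f := fun i x => ENNReal.ofReal (Real.exp ((√(3 / 4) * g * v i) * x))) fun i => by fun_prop]
    simp_rw [lintegral_exp_mul_gaussianReal]
    rw [← ENNReal.ofReal_prod_of_nonneg fun _ _ => (Real.exp_pos _).le, ← Real.exp_sum]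
    refine ENNReal.ofReal_le_ofReal (Real.exp_le_exp.mpr ?_)
    have : ∑ i, (√(3 / 4) * g * v i) ^ 2 / 2 = 3 / 8 * g ^ 2 * sqNorm v := by
      rw [sqNorm, Finset.mul_sum]
      refine Finset.sum_congr rfl fun i _ => ?_
      rw [mul_pow, mul_pow, Real.sq_sqrt (by norm_num)]
      ring
    rw [this]
    exact mul_le_of_le_one_right (by positivity) hv
  refine (lintegral_mono h2).trans ?_
  rw [lintegral_exp_mul_sq_gaussianReal (by norm_num)]
  rw [show (1 - 2 * (3 / 8) : ℝ) = (1 / 2) ^ 2 by norm_num, Real.sqrt_sq (by norm_num)]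
  simp

/-- Completing the square bounds `⟨a,u⟩` by `‖u‖²/(4c) + c⟨a,v⟩²` with `v = u/‖u‖`. -/
theorem HasSqExpMoment.lintegral_exp_le {P : Measure (Fin d → ℝ)} {c : ℝ} (hc : 0 < c)
    (hP : HasSqExpMoment P c) (u : Fin d → ℝ) :
    ∫⁻ a, ENNReal.ofReal (Real.exp (a ⬝ᵥ u)) ∂P ≤
      2 * ENNReal.ofReal (Real.exp (sqNorm u / (4 * c))) := by
  set v : Fin d → ℝ := (√(sqNorm u))⁻¹ • u with hv
  have hnn := sqNorm_nonneg u
  have hv1 : sqNorm v ≤ 1 := by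
    rw [hv, sqNorm_smul, inv_pow, Real.sq_sqrt hnn]
    exact inv_mul_le_one
  have huv : u = √(sqNorm u) • v := by
    by_cases h0 : u = 0
    · simp [hv, h0]
    · rw [hv, smul_smul, mul_inv_cancel₀ (Real.sqrt_pos.mpr (sqNorm_pos h0)).ne', one_smul]
  have hpt : ∀ a : Fin d → ℝ, ENNReal.ofReal (Real.exp (a ⬝ᵥ u)) ≤
      ENNReal.ofReal (Real.exp (sqNorm u / (4 * c))) *
        ENNReal.ofReal (Real.exp (c * (a ⬝ᵥ v) ^ 2)) := fun a => by
    rw [← ENNReal.ofReal_mul (Real.exp_pos _).le, ← Real.exp_add]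
    refine ENNReal.ofReal_le_ofReal (Real.exp_le_exp.mpr ?_)
    have h1 : a ⬝ᵥ u = √(sqNorm u) * (a ⬝ᵥ v) := by
      conv_lhs => rw [huv, dotProduct_smul, smul_eq_mul]
    have h2 : sqNorm u / (4 * c) + c * (a ⬝ᵥ v) ^ 2 - a ⬝ᵥ u =
        (√(sqNorm u) - 2 * c * (a ⬝ᵥ v)) ^ 2 / (4 * c) := by
      rw [h1, sub_sq, Real.sq_sqrt hnn]
      field_simp
      ring
    have h3 : 0 ≤ (√(sqNorm u) - 2 * c * (a ⬝ᵥ v)) ^ 2 / (4 * c) := by positivity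
    linarith
  refine (lintegral_mono hpt).trans ?_
  have := measurable_dotProduct_const v
  rw [lintegral_const_mul _ (by fun_prop), mul_comm]
  exact mul_le_mul_left (hP v hv1) _

end ExponentialMoments

/-! ### Quadratic forms -/

section QuadraticForms

variable {n d : ℕ}

/-- The eigenbasis is returned both as a matrix and as an orthonormal basis; the latter feeds the
rotation invariance of the Gaussian law. -/
theorem exists_orthonormal_diagonalization {R : Matrix (Fin d) (Fin d) ℝ} (hR : R.IsHermitian)
    (h01 : ∀ x, 0 ≤ x ⬝ᵥ R *ᵥ x ∧ x ⬝ᵥ R *ᵥ x ≤ sqNorm x) :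
    ∃ (b : OrthonormalBasis (Fin d) ℝ (EuclideanSpace ℝ (Fin d))) (V : Matrix (Fin d) (Fin d) ℝ)
      (r : Fin d → ℝ), (∀ i j, V i j = b j i) ∧ V * Vᵀ = 1 ∧ Vᵀ * V = 1 ∧
        (∀ x, x ⬝ᵥ R *ᵥ x = ∑ k, r k * (Vᵀ *ᵥ x) k ^ 2) ∧ R.trace = ∑ k, r k ∧
        ∀ k, 0 ≤ r k ∧ r k ≤ 1 := by
  have hVV : (hR.eigenvectorUnitary : Matrix (Fin d) (Fin d) ℝ) *
      (hR.eigenvectorUnitary : Matrix (Fin d) (Fin d) ℝ)ᵀ = 1 := by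
    simpa [Matrix.star_eq_conjTranspose, Matrix.conjTranspose_eq_transpose_of_trivial] using
      Unitary.coe_mul_star_self hR.eigenvectorUnitary
  have hVV' : (hR.eigenvectorUnitary : Matrix (Fin d) (Fin d) ℝ)ᵀ *
      (hR.eigenvectorUnitary : Matrix (Fin d) (Fin d) ℝ) = 1 := by
    simpa [Matrix.star_eq_conjTranspose, Matrix.conjTranspose_eq_transpose_of_trivial] using
      Unitary.coe_star_mul_self hR.eigenvectorUnitary
  have hRV : R = (hR.eigenvectorUnitary : Matrix (Fin d) (Fin d) ℝ) *
      Matrix.diagonal hR.eigenvalues * (hR.eigenvectorUnitary : Matrix (Fin d) (Fin d) ℝ)ᵀ := by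
    conv_lhs => rw [hR.spectral_theorem]
    rw [Unitary.conjStarAlgAut_apply, Matrix.star_eq_conjTranspose,
      Matrix.conjTranspose_eq_transpose_of_trivial]
    rfl
  set V : Matrix (Fin d) (Fin d) ℝ := hR.eigenvectorUnitary.val
  have hform : ∀ x, x ⬝ᵥ R *ᵥ x = ∑ k, hR.eigenvalues k * (Vᵀ *ᵥ x) k ^ 2 := fun x => by
    refine (congrArg (fun M => x ⬝ᵥ M *ᵥ x) hRV).trans ?_
    rw [← Matrix.mulVec_mulVec, ← Matrix.mulVec_mulVec, Matrix.dotProduct_mulVec,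
      ← Matrix.mulVec_transpose, dotProduct]
    refine Finset.sum_congr rfl fun k _ => ?_
    rw [Matrix.mulVec_diagonal]
    ring
  refine ⟨hR.eigenvectorBasis, V, hR.eigenvalues, fun i j => hR.eigenvectorUnitary_apply i j,
    hVV, hVV', hform, ?_, fun k => ?_⟩
  · conv_lhs => rw [hRV]
    rw [Matrix.trace_mul_cycle, hVV', one_mul, Matrix.trace_diagonal]
  · have h := h01 (V *ᵥ Pi.single k 1)
    have h1 : Vᵀ *ᵥ (V *ᵥ Pi.single k 1) = Pi.single k 1 := by
      rw [Matrix.mulVec_mulVec, hVV', Matrix.one_mulVec]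
    have h2 : sqNorm (V *ᵥ Pi.single k 1) = 1 := by
      rw [sqNorm_eq_dotProduct, Matrix.dotProduct_mulVec, ← Matrix.mulVec_transpose, h1]
      simp
    rw [hform, h1, h2] at h
    simpa [Pi.single_apply] using h

/-- The exponential moment of a quadratic form of a vector with sub-Gaussian marginals. -/
theorem HasSqExpMoment.lintegral_exp_quadratic_le {P : Measure (Fin d → ℝ)}
    [IsProbabilityMeasure P] {c : ℝ} (hc : 0 < c)
    (hP : HasSqExpMoment P c) {R : Matrix (Fin d) (Fin d) ℝ} (hR : R.IsHermitian)
    (h01 : ∀ x, 0 ≤ x ⬝ᵥ R *ᵥ x ∧ x ⬝ᵥ R *ᵥ x ≤ sqNorm x) :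
    ∫⁻ a, ENNReal.ofReal (Real.exp (c / 2 * (a ⬝ᵥ R *ᵥ a) - R.trace / 2)) ∂P ≤ 2 := by
  obtain ⟨-, V, r, -, -, hV, hform, htr, hr⟩ := exists_orthonormal_diagonalization hR h01
  -- Gaussian linearization: the quadratic exponential is an average over `g` of exponentials of
  -- linear forms in `a`. After exchanging integrals, the linear bound costs a single factor 2,
  -- whatever the dimension.
  have hlin : ∀ a : Fin d → ℝ, ENNReal.ofReal (Real.exp (c / 2 * (a ⬝ᵥ R *ᵥ a))) =
      ∫⁻ g, ENNReal.ofReal (Real.exp (a ⬝ᵥ V *ᵥ fun k => √(c * r k) * g k))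
        ∂(gaussianFeatures d) := fun a => by
    have h1 : ∀ g : Fin d → ℝ,
        ENNReal.ofReal (Real.exp (a ⬝ᵥ V *ᵥ fun k => √(c * r k) * g k)) =
          ∏ k, ENNReal.ofReal (Real.exp ((√(c * r k) * (Vᵀ *ᵥ a) k) * g k)) := fun g => by
      rw [← ENNReal.ofReal_prod_of_nonneg fun _ _ => (Real.exp_pos _).le, ← Real.exp_sum,
        Matrix.dotProduct_mulVec, ← Matrix.mulVec_transpose, dotProduct]
      congr 2
      exact Finset.sum_congr rfl fun i _ => by ring
    simp_rw [h1]
    rw [gaussianFeatures, lintegral_pi_prod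
      (f := fun k x => ENNReal.ofReal (Real.exp ((√(c * r k) * (Vᵀ *ᵥ a) k) * x)))
      fun i => by fun_prop]
    simp_rw [lintegral_exp_mul_gaussianReal]
    rw [← ENNReal.ofReal_prod_of_nonneg fun _ _ => (Real.exp_pos _).le, ← Real.exp_sum, hform,
      Finset.mul_sum]
    congr 2
    refine Finset.sum_congr rfl fun k _ => ?_
    rw [mul_pow, Real.sq_sqrt (mul_nonneg hc.le (hr k).1)]
    ring
  have hmain : ∫⁻ a, ENNReal.ofReal (Real.exp (c / 2 * (a ⬝ᵥ R *ᵥ a))) ∂P ≤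
      2 * ENNReal.ofReal (Real.exp (R.trace / 2)) := by
    simp_rw [hlin]
    rw [lintegral_lintegral_swap (by
      unfold Matrix.mulVec dotProduct
      fun_prop)]
    have h2 : ∀ g : Fin d → ℝ, sqNorm (V *ᵥ fun k => √(c * r k) * g k) =
        ∑ k, c * r k * g k ^ 2 := fun g => by
      rw [sqNorm_eq_dotProduct, Matrix.dotProduct_mulVec, ← Matrix.mulVec_transpose,
        Matrix.mulVec_mulVec, hV, Matrix.one_mulVec, dotProduct]
      refine Finset.sum_congr rfl fun k _ => ?_
      have := Real.mul_self_sqrt (mul_nonneg hc.le (hr k).1)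
      calc _ = (√(c * r k) * √(c * r k)) * g k ^ 2 := by ring
        _ = _ := by rw [this]
    refine (lintegral_mono fun g => hP.lintegral_exp_le hc _).trans ?_
    have h3 : ∀ g : Fin d → ℝ,
        ENNReal.ofReal (Real.exp (sqNorm (V *ᵥ fun k => √(c * r k) * g k) / (4 * c))) =
          ∏ k, ENNReal.ofReal (Real.exp (r k / 4 * g k ^ 2)) := fun g => by
      rw [← ENNReal.ofReal_prod_of_nonneg fun _ _ => (Real.exp_pos _).le, ← Real.exp_sum, h2,
        Finset.sum_div]
      congr 2
      refine Finset.sum_congr rfl fun k _ => ?_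
      field_simp
    simp_rw [h3]
    rw [lintegral_const_mul _ (by fun_prop), gaussianFeatures, lintegral_pi_prod
      (f := fun k x => ENNReal.ofReal (Real.exp (r k / 4 * x ^ 2))) fun i => by fun_prop]
    refine mul_le_mul_right ?_ 2
    rw [htr, Finset.sum_div, Real.exp_sum,
      ENNReal.ofReal_prod_of_nonneg fun _ _ => (Real.exp_pos _).le]
    refine Finset.prod_le_prod' fun k _ => ?_
    rw [lintegral_exp_mul_sq_gaussianReal (by linarith [(hr k).2])]
    refine ENNReal.ofReal_le_ofReal ?_
    -- This is `exp(-r) ≤ 1/(1+r) ≤ 1 - r/2`, the second step using `0 ≤ r ≤ 1`; it turns the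
    -- chi-square factor into `exp(r/2)`.
    have h4 : Real.exp (-(r k)) ≤ 1 - 2 * (r k / 4) := by
      have h5 := Real.add_one_le_exp (r k)
      have h6 : 0 < 1 + r k := by linarith [(hr k).1]
      rw [Real.exp_neg]
      refine (inv_anti₀ h6 (by linarith)).trans ?_
      rw [inv_le_iff_one_le_mul₀ h6]
      nlinarith [hr k]
    rw [← Real.sqrt_inv, Real.sqrt_le_left (Real.exp_pos _).le, ← Real.exp_nat_mul]
    refine (inv_anti₀ (Real.exp_pos _) h4).trans_eq ?_
    rw [← Real.exp_neg, neg_neg]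
    congr 1
    push_cast; ring
  have hsplit : ∀ a : Fin d → ℝ,
      ENNReal.ofReal (Real.exp (c / 2 * (a ⬝ᵥ R *ᵥ a) - R.trace / 2)) =
        ENNReal.ofReal (Real.exp (c / 2 * (a ⬝ᵥ R *ᵥ a))) *
          ENNReal.ofReal (Real.exp (-(R.trace / 2))) := fun a => by
    rw [← ENNReal.ofReal_mul (Real.exp_pos _).le, ← Real.exp_add, sub_eq_add_neg]
  simp_rw [hsplit]
  rw [lintegral_mul_const _ (by unfold Matrix.mulVec dotProduct; fun_prop)]
  refine (mul_le_mul_left hmain _).trans_eq ?_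
  rw [mul_assoc, ← ENNReal.ofReal_mul (Real.exp_pos _).le, ← Real.exp_add, add_neg_cancel,
    Real.exp_zero, ENNReal.ofReal_one, mul_one]

theorem lintegral_trainNoise {σ : ℝ} {f : (Fin n → ℝ) → ENNReal} (hf : Measurable f) :
    ∫⁻ w, f w ∂(trainNoise n σ) = ∫⁻ g, f (σ • g) ∂(gaussianFeatures n) := by
  have h1 : noiseLaw σ = (gaussianReal 0 1).map (σ * ·) := by
    rw [gaussianReal_map_const_mul, mul_zero, mul_one]
    rfl
  have h2 : trainNoise n σ = (gaussianFeatures n).map fun g i => σ * g i := by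
    have : ∀ i : Fin n, SigmaFinite ((gaussianReal 0 1).map (σ * ·)) := fun i =>
      h1 ▸ inferInstance
    rw [gaussianFeatures, Measure.pi_map_pi fun i => by fun_prop, ← h1]
    rfl
  rw [h2, lintegral_map hf (by fun_prop)]
  rfl

theorem lintegral_gaussianFeatures_rotate {f : (Fin n → ℝ) → ENNReal} (hf : Measurable f)
    {b : OrthonormalBasis (Fin n) ℝ (EuclideanSpace ℝ (Fin n))} {V : Matrix (Fin n) (Fin n) ℝ}
    (hV : ∀ i j, V i j = b j i) :
    ∫⁻ g, f g ∂(gaussianFeatures n) = ∫⁻ g, f (V *ᵥ g) ∂(gaussianFeatures n) := by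
  have hf' : Measurable fun y : EuclideanSpace ℝ (Fin n) => f y.ofLp := hf.comp (by fun_prop)
  have h1 : ∫⁻ y, f y.ofLp ∂(stdGaussian (EuclideanSpace ℝ (Fin n))) =
      ∫⁻ g, f g ∂(gaussianFeatures n) := by
    rw [← map_pi_eq_stdGaussian, lintegral_map hf' (by fun_prop)]
    rfl
  have h2 : ∫⁻ y, f y.ofLp ∂(stdGaussian (EuclideanSpace ℝ (Fin n))) =
      ∫⁻ g, f (V *ᵥ g) ∂(gaussianFeatures n) := by
    rw [stdGaussian_eq_map_pi_orthonormalBasis b, lintegral_map hf' (by fun_prop)]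
    refine lintegral_congr fun g => ?_
    congr 1
    funext i
    simp [Matrix.mulVec, dotProduct, hV, mul_comm]
  rw [← h1, h2]

/-- A lower-tail exponential moment of a positive semidefinite quadratic form of the noise. -/
theorem lintegral_exp_neg_quadratic_trainNoise_le {σ : ℝ} (hσ : 0 < σ) {L : ℝ} (hL : 0 ≤ L)
    {N : Matrix (Fin n) (Fin n) ℝ} (hN : N.IsHermitian)
    (h01 : ∀ x, 0 ≤ x ⬝ᵥ N *ᵥ x ∧ x ⬝ᵥ N *ᵥ x ≤ sqNorm x) :
    ∫⁻ w, ENNReal.ofReal (Real.exp (-(L / (2 * σ ^ 2) * (w ⬝ᵥ N *ᵥ w)))) ∂(trainNoise n σ) ≤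
      ENNReal.ofReal (Real.exp (-(N.trace * Real.log (1 + L) / 2))) := by
  obtain ⟨b, V, y, hVb, -, hV, hform, htr, hy⟩ := exists_orthonormal_diagonalization hN h01
  have hm : Measurable fun w : Fin n → ℝ =>
      ENNReal.ofReal (Real.exp (-(L / (2 * σ ^ 2) * (w ⬝ᵥ N *ᵥ w)))) := by
    unfold Matrix.mulVec dotProduct; fun_prop
  have hm' : Measurable fun g : Fin n → ℝ =>
      ENNReal.ofReal (Real.exp (-(L / (2 * σ ^ 2) * ((σ • g) ⬝ᵥ N *ᵥ (σ • g))))) :=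
    hm.comp (by fun_prop)
  rw [lintegral_trainNoise hm, lintegral_gaussianFeatures_rotate hm' hVb]
  have h1 : ∀ g : Fin n → ℝ, ENNReal.ofReal (Real.exp (-(L / (2 * σ ^ 2) *
      ((σ • V *ᵥ g) ⬝ᵥ N *ᵥ (σ • V *ᵥ g))))) =
        ∏ k, ENNReal.ofReal (Real.exp (-(L * y k / 2) * g k ^ 2)) := fun g => by
    rw [← ENNReal.ofReal_prod_of_nonneg fun _ _ => (Real.exp_pos _).le, ← Real.exp_sum, hform,
      Matrix.mulVec_smul, Matrix.mulVec_mulVec, hV, Matrix.one_mulVec, Finset.mul_sum,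
      ← Finset.sum_neg_distrib]
    congr 2
    refine Finset.sum_congr rfl fun k _ => ?_
    simp only [Pi.smul_apply, smul_eq_mul]
    field_simp
  simp_rw [h1]
  rw [gaussianFeatures, lintegral_pi_prod
    (f := fun k x => ENNReal.ofReal (Real.exp (-(L * y k / 2) * x ^ 2))) fun i => by fun_prop]
  rw [htr, Finset.sum_mul, Finset.sum_div, ← Finset.sum_neg_distrib, Real.exp_sum,
    ENNReal.ofReal_prod_of_nonneg fun _ _ => (Real.exp_pos _).le]
  refine Finset.prod_le_prod' fun k _ => ?_
  have hLy : 0 ≤ L * y k := mul_nonneg hL (hy k).1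
  rw [lintegral_exp_mul_sq_gaussianReal (by linarith)]
  refine ENNReal.ofReal_le_ofReal ?_
  -- Bernoulli's inequality `(1+L)^y ≤ 1 + Ly` on `[0,1]` is what makes the bound depend only on the
  -- trace.
  have h2 : Real.exp (y k * Real.log (1 + L)) ≤ 1 - 2 * -(L * y k / 2) := by
    have := rpow_one_add_le_one_add_mul_self (s := L) (by linarith) (hy k).1 (hy k).2
    rw [Real.rpow_def_of_pos (by linarith), mul_comm] at this
    linarith
  rw [← Real.sqrt_inv, Real.sqrt_le_left (Real.exp_pos _).le, ← Real.exp_nat_mul]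
  refine (inv_anti₀ (Real.exp_pos _) h2).trans_eq ?_
  rw [← Real.exp_neg]
  congr 1
  push_cast; ring

/-- The lower tail of the squared norm of the noise. -/
theorem trainNoise_sqNorm_le_le {σ : ℝ} (hσ : 0 < σ) {δ : ℝ} (hδ : 0 < δ) (hδ1 : δ < 1) :
    trainNoise n σ {w | sqNorm w ≤ n * σ ^ 2 * ((1 - δ) / Real.exp 1)} ≤
      ENNReal.ofReal (Real.exp (-(n * δ ^ 2 / 2))) := by
  set x : ℝ := (1 - δ) / Real.exp 1 with hx
  have hx0 : 0 < x := div_pos (by linarith) (Real.exp_pos 1)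
  have hx1 : x ≤ 1 := by
    rw [hx, div_le_one (Real.exp_pos 1)]
    linarith [Real.add_one_le_exp 1]
  -- The optimal Chernoff parameter for the threshold `x`. The factor `1/e` in `x` supplies the `1`
  -- in `log(1+L) ≥ 1 + δ`.
  set L : ℝ := x⁻¹ - 1 with hLdef
  have hL : 0 ≤ L := by linarith [(one_le_inv₀ hx0).mpr hx1]
  have hlog : Real.log (1 + L) ≥ 1 + δ := by
    rw [hLdef, add_sub_cancel, Real.log_inv, hx, Real.log_div (by linarith) (Real.exp_pos 1).ne',
      Real.log_exp]
    linarith [Real.log_le_sub_one_of_pos (show 0 < 1 - δ by linarith)]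
  have h1 := lintegral_exp_neg_quadratic_trainNoise_le (n := n) hσ hL
    (N := 1) Matrix.isHermitian_one (fun x => by
      rw [Matrix.one_mulVec, ← sqNorm_eq_dotProduct]; exact ⟨sqNorm_nonneg x, le_rfl⟩)
  simp only [Matrix.one_mulVec, ← sqNorm_eq_dotProduct, Matrix.trace_one, Fintype.card_fin] at h1
  have hm : Measurable fun w : Fin n → ℝ =>
      ENNReal.ofReal (Real.exp (-(L / (2 * σ ^ 2) * sqNorm w))) := by
    have := measurable_sqNorm (ι := Fin n)
    fun_prop
  have h2 := meas_ge_le_lintegral_div (μ := trainNoise n σ) hm.aemeasurable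
    (ε := ENNReal.ofReal (Real.exp (-(L / (2 * σ ^ 2) * (n * σ ^ 2 * x)))))
    (ENNReal.ofReal_pos.mpr (Real.exp_pos _)).ne' ENNReal.ofReal_ne_top
  refine (measure_mono fun w hw => ?_).trans (h2.trans ((ENNReal.div_le_div_right h1 _).trans ?_))
  · refine ENNReal.ofReal_le_ofReal (Real.exp_le_exp.mpr (neg_le_neg ?_))
    exact mul_le_mul_of_nonneg_left hw (by positivity)
  · rw [← ENNReal.ofReal_div_of_pos (Real.exp_pos _), ← Real.exp_sub]
    refine ENNReal.ofReal_le_ofReal (Real.exp_le_exp.mpr ?_)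
    have h3 : L / (2 * σ ^ 2) * (n * σ ^ 2 * x) = n * (1 - x) / 2 := by
      rw [hLdef]; field_simp
    rw [h3]
    have h4 : (n : ℝ) * (1 + δ) ≤ n * Real.log (1 + L) := by gcongr
    have h5 : (n : ℝ) * δ ^ 2 ≤ n * δ := by gcongr; nlinarith
    have h6 : (0 : ℝ) ≤ n * x := by positivity
    linarith

end QuadraticForms

/-! ### The test error -/

section TestError

variable {d : ℕ}

theorem isWhitened_gaussianFeatures (d : ℕ) : IsWhitened (gaussianFeatures d) := by
  intro i j
  have h2 : ∫ x, x ^ 2 ∂(gaussianReal 0 1) = 1 := by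
    have := variance_id_gaussianReal (μ := 0) (v := 1)
    rw [variance_eq_sub (memLp_id_gaussianReal 2)] at this
    simpa using this
  split_ifs with h
  · subst h
    have := integral_comp_eval (μ := fun _ : Fin d => gaussianReal 0 1) (i := i)
      (f := fun x => x ^ 2) (by fun_prop)
    simp_rw [← sq]
    exact this.trans h2
  · have hind := (iIndepFun_pi (μ := fun _ : Fin d => gaussianReal 0 1) (X := fun _ => id)
      fun i => aemeasurable_id).indepFun h
    have := hind.integral_mul_eq_mul_integral
      (measurable_pi_apply i).aestronglyMeasurable (measurable_pi_apply j).aestronglyMeasurable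
    have h0 : ∫ a : Fin d → ℝ, a i ∂(Measure.pi fun _ => gaussianReal 0 1) = 0 := by
      have := integral_comp_eval (μ := fun _ : Fin d => gaussianReal 0 1) (i := i)
        (f := fun x => x) (by fun_prop)
      rw [this, integral_id_gaussianReal]
    refine this.trans ?_
    simp [h0]

/-- A non-integrable square would have integral zero by convention, whereas whitening says one. -/
theorem IsWhitened.memLp_eval {P : Measure (Fin d → ℝ)} (hP : IsWhitened P) (i : Fin d) :
    MemLp (fun a => a i) 2 P := by
  rw [memLp_two_iff_integrable_sq (measurable_pi_apply i).aestronglyMeasurable]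
  simp_rw [sq]
  by_contra h
  have := hP i i
  rw [integral_undef h] at this
  simp at this

theorem IsWhitened.testMSE_zero {P : Measure (Fin d → ℝ)} [IsProbabilityMeasure P]
    (hP : IsWhitened P) (σ : ℝ) (α : Fin d → ℝ) : testMSE P σ 0 α = sqNorm α := by
  have hX : MemLp (fun a : Fin d → ℝ => a ⬝ᵥ α) 2 P := by
    unfold dotProduct
    exact memLp_finsetSum _ fun i _ => (hP.memLp_eval i).mul_const (α i)
  have hX2 : ∫ a, (a ⬝ᵥ α) ^ 2 ∂P = sqNorm α := by
    have h1 : ∀ a : Fin d → ℝ, (a ⬝ᵥ α) ^ 2 = ∑ i, ∑ j, α i * α j * (a i * a j) := fun a => by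
      rw [sq, dotProduct, Finset.sum_mul_sum]
      exact Finset.sum_congr rfl fun i _ => Finset.sum_congr rfl fun j _ => by ring
    have h2 : ∀ i j, Integrable (fun a : Fin d → ℝ => α i * α j * (a i * a j)) P := fun i j =>
      ((hP.memLp_eval i).integrable_mul (hP.memLp_eval j)).const_mul _
    simp_rw [h1]
    rw [integral_finsetSum _ fun i _ => integrable_finsetSum _ fun j _ => h2 i j]
    simp_rw [integral_finsetSum _ fun j _ => h2 _ j, integral_const_mul, hP _ _]
    simp [sqNorm, sq]
  have hW : MemLp (fun x : ℝ => x) 2 (noiseLaw σ) := memLp_id_gaussianReal 2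
  have hW1 : ∫ x, x ∂(noiseLaw σ) = 0 := integral_id_gaussianReal
  have hW2 : ∫ x, x ^ 2 ∂(noiseLaw σ) = σ ^ 2 := by
    have : Var[fun x => x; noiseLaw σ] = σ ^ 2 := variance_fun_id_gaussianReal
    rw [variance_eq_sub hW] at this
    simpa [hW1] using this
  have hexp : ∀ z : (Fin d → ℝ) × ℝ, ((z.1 ⬝ᵥ (0 : Fin d → ℝ) + z.2) - z.1 ⬝ᵥ α) ^ 2 =
      z.2 ^ 2 + (z.1 ⬝ᵥ α) ^ 2 - 2 * ((z.1 ⬝ᵥ α) * z.2) := fun z => by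
    rw [dotProduct_zero]; ring
  have hi1 : Integrable (fun z : (Fin d → ℝ) × ℝ => z.2 ^ 2) (P.prod (noiseLaw σ)) :=
    hW.integrable_sq.comp_snd P
  have hi2 : Integrable (fun z : (Fin d → ℝ) × ℝ => (z.1 ⬝ᵥ α) ^ 2) (P.prod (noiseLaw σ)) :=
    hX.integrable_sq.comp_fst (noiseLaw σ)
  have hi3 : Integrable (fun z : (Fin d → ℝ) × ℝ => (z.1 ⬝ᵥ α) * z.2) (P.prod (noiseLaw σ)) :=
    (hX.integrable one_le_two).mul_prod (hW.integrable one_le_two)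
  unfold testMSE
  simp_rw [hexp]
  rw [integral_sub (f := fun z : (Fin d → ℝ) × ℝ => z.2 ^ 2 + (z.1 ⬝ᵥ α) ^ 2) (hi1.add hi2)
    (hi3.const_mul 2), integral_add hi1 hi2, integral_const_mul,
    integral_prod_mul (fun a : Fin d → ℝ => a ⬝ᵥ α) (fun x : ℝ => x), hW1,
    integral_fun_snd (fun x : ℝ => x ^ 2), integral_fun_fst (fun a : Fin d → ℝ => (a ⬝ᵥ α) ^ 2),
    hW2, hX2]
  simp

end TestError

/-! ### The norm of column submatrices -/

section ColumnSubmatrices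

variable {n d : ℕ}

theorem sqNorm_add_add_sqNorm_sub {ι : Type*} [Fintype ι] (v z : ι → ℝ) :
    sqNorm (v + z) + sqNorm (v - z) = 2 * sqNorm v + 2 * sqNorm z := by
  simp only [sqNorm, Finset.mul_sum, ← Finset.sum_add_distrib, Pi.add_apply, Pi.sub_apply]
  exact Finset.sum_congr rfl fun i _ => by ring

theorem measurableSet_sqNorm_le (ι : Type*) [Fintype ι] (r : ℝ) :
    MeasurableSet {x : ι → ℝ | sqNorm x ≤ r} :=
  measurableSet_le measurable_sqNorm measurable_const

theorem volume_sqNorm_le_one_ne_zero (n : ℕ) :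
    volume {x : Fin n → ℝ | sqNorm x ≤ 1} ≠ 0 := by
  have hopen : IsOpen {x : Fin n → ℝ | sqNorm x < 1} :=
    isOpen_lt (by unfold sqNorm; fun_prop) continuous_const
  have := hopen.measure_pos volume ⟨0, by simp [sqNorm]⟩
  exact (this.trans_le (measure_mono fun x (hx : sqNorm x < 1) => hx.le)).ne'

theorem volume_sqNorm_le_one_ne_top (n : ℕ) :
    volume {x : Fin n → ℝ | sqNorm x ≤ 1} ≠ ⊤ := by
  refine ((measure_mono fun x hx => ?_).trans_lt
    (measure_closedBall_lt_top (x := (0 : Fin n → ℝ)) (r := 1))).ne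
  rw [mem_closedBall_zero_iff, pi_norm_le_iff_of_nonneg zero_le_one]
  intro i
  rw [Real.norm_eq_abs, ← sq_le_one_iff_abs_le_one]
  exact (Finset.single_le_sum (f := fun i => x i ^ 2) (fun _ _ => sq_nonneg _)
    (Finset.mem_univ i)).trans hx

open scoped Pointwise in
theorem volume_sqNorm_le_four (n : ℕ) :
    volume {x : Fin n → ℝ | sqNorm x ≤ 4} =
      ENNReal.ofReal (2 ^ n) * volume {x : Fin n → ℝ | sqNorm x ≤ 1} := by
  have h : {x : Fin n → ℝ | sqNorm x ≤ 4} = (2 : ℝ) • {x : Fin n → ℝ | sqNorm x ≤ 1} := by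
    ext x
    rw [Set.mem_smul_set_iff_inv_smul_mem₀ two_ne_zero]
    simp only [Set.mem_ofPred_eq, sqNorm_smul]
    constructor <;> intro h <;> linarith
  rw [h, Measure.addHaar_smul]
  simp

/-- A quadratic form at a point of the unit ball is controlled by its exponential average over the
ball of radius two. -/
theorem exp_sqNorm_mul_volume_le {m : ℕ} (T : (Fin n → ℝ) →ₗ[ℝ] (Fin m → ℝ)) {b : ℝ} (hb : 0 ≤ b)
    {v : Fin n → ℝ} (hv : sqNorm v ≤ 1) :
    ENNReal.ofReal (Real.exp (b * sqNorm (T v))) * volume {x : Fin n → ℝ | sqNorm x ≤ 1} ≤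
      ∫⁻ x in {x : Fin n → ℝ | sqNorm x ≤ 4}, ENNReal.ofReal (Real.exp (b * sqNorm (T x))) := by
  set f : (Fin n → ℝ) → ENNReal := fun x => ENNReal.ofReal (Real.exp (b * sqNorm (T x))) with hf
  have hTm : Measurable T := T.continuous_of_finiteDimensional.measurable
  have hfm : Measurable f := by
    have := (measurable_sqNorm (ι := Fin m)).comp hTm
    exact ENNReal.measurable_ofReal.comp (Real.measurable_exp.comp (this.const_mul b))
  set D : Set (Fin n → ℝ) := {x | sqNorm x ≤ 4} with hD
  have hDm : MeasurableSet D := measurableSet_sqNorm_le _ 4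
  have hU : MeasurableSet {x : Fin n → ℝ | sqNorm x ≤ 1} := measurableSet_sqNorm_le _ 1
  have hgm : Measurable (D.indicator f) := hfm.indicator hDm
  -- Lebesgue measure is invariant under `z ↦ v + z` and `z ↦ v - z`. By the parallelogram law and
  -- convexity of `exp`, the two values at `v ± z` average to at least `f v` for every `z` in the
  -- unit ball.
  have h1 : 2 * ∫⁻ x, D.indicator f x =
      ∫⁻ z, (D.indicator f (v + z) + D.indicator f (v - z)) := by
    rw [lintegral_add_left (f := fun z => D.indicator f (v + z))
      (hgm.comp (measurable_const_add v)), lintegral_add_left_eq_self (D.indicator f) v,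
      lintegral_sub_left_eq_self (D.indicator f) v, two_mul]
  have h2 : 2 * (f v * volume {x : Fin n → ℝ | sqNorm x ≤ 1}) ≤
      2 * ∫⁻ x, D.indicator f x := by
    rw [h1, ← mul_assoc, ← lintegral_indicator_const hU]
    refine lintegral_mono fun z => ?_
    by_cases hz : sqNorm z ≤ 1
    · have hpar := sqNorm_add_add_sqNorm_sub v z
      have hp := sqNorm_nonneg (v + z)
      have hm := sqNorm_nonneg (v - z)
      rw [Set.indicator_of_mem (show z ∈ {x : Fin n → ℝ | sqNorm x ≤ 1} from hz),
        Set.indicator_of_mem (show v + z ∈ D by simp only [hD, Set.mem_ofPred_eq]; linarith),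
        Set.indicator_of_mem (show v - z ∈ D by simp only [hD, Set.mem_ofPred_eq]; linarith)]
      simp only [hf]
      rw [← ENNReal.ofReal_add (Real.exp_pos _).le (Real.exp_pos _).le,
        ← ENNReal.ofReal_ofNat, ← ENNReal.ofReal_mul zero_le_two]
      refine ENNReal.ofReal_le_ofReal ?_
      have hT := sqNorm_add_add_sqNorm_sub (T v) (T z)
      rw [← map_add, ← map_sub] at hT
      have hTz := sqNorm_nonneg (T z)
      set p := b * sqNorm (T (v + z))
      set q := b * sqNorm (T (v - z))
      have hpq : b * sqNorm (T v) ≤ (p + q) / 2 := by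
        have : p + q = b * (2 * sqNorm (T v) + 2 * sqNorm (T z)) := by rw [← hT]; ring
        nlinarith
      have hcs : 2 * Real.exp ((p + q) / 2) ≤ Real.exp p + Real.exp q := by
        have e : ∀ x : ℝ, Real.exp x = Real.exp (x / 2) ^ 2 := fun x => by
          rw [← Real.exp_nat_mul]; congr 1; push_cast; ring
        rw [e p, e q, add_div, Real.exp_add]
        nlinarith [sq_nonneg (Real.exp (p / 2) - Real.exp (q / 2))]
      exact (mul_le_mul_of_nonneg_left (Real.exp_le_exp.mpr hpq) zero_le_two).trans hcs
    · rw [Set.indicator_of_notMem (show z ∉ {x : Fin n → ℝ | sqNorm x ≤ 1} from hz)]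
      exact zero_le
  rw [lintegral_indicator hDm] at h2
  exact (ENNReal.mul_le_mul_iff_right two_ne_zero ENNReal.ofNat_ne_top).mp h2

theorem HasSqExpMoment.lintegral_exp_sqNorm_mulVec_le {P : Measure (Fin d → ℝ)}
    [IsProbabilityMeasure P] {c : ℝ} (hP : HasSqExpMoment P c) {x : Fin d → ℝ}
    (hx : sqNorm x ≤ 4) :
    ∫⁻ A, ENNReal.ofReal (Real.exp (c / 4 * sqNorm (Matrix.of A *ᵥ x))) ∂(trainFeatures P n) ≤
      ENNReal.ofReal (2 ^ n) := by
  have h1 : ∀ A : Fin n → Fin d → ℝ,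
      ENNReal.ofReal (Real.exp (c / 4 * sqNorm (Matrix.of A *ᵥ x))) =
        ∏ i, ENNReal.ofReal (Real.exp (c * (A i ⬝ᵥ ((1 / 2 : ℝ) • x)) ^ 2)) := fun A => by
    rw [← ENNReal.ofReal_prod_of_nonneg fun _ _ => (Real.exp_pos _).le, ← Real.exp_sum, sqNorm,
      Finset.mul_sum]
    congr 2
    refine Finset.sum_congr rfl fun i _ => ?_
    rw [dotProduct_smul, smul_eq_mul]
    change c / 4 * (A i ⬝ᵥ x) ^ 2 = _
    ring
  simp_rw [h1]
  have hm := measurable_dotProduct_const ((1 / 2 : ℝ) • x)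
  rw [trainFeatures, lintegral_pi_prod
    (f := fun _ a => ENNReal.ofReal (Real.exp (c * (a ⬝ᵥ ((1 / 2 : ℝ) • x)) ^ 2)))
    fun i => by fun_prop]
  refine (Finset.prod_le_pow_card _ _ 2 fun i _ => hP _ ?_).trans_eq ?_
  · rw [sqNorm_smul]; linarith
  · simp [ENNReal.ofReal_pow]

/-- Averaging over the ball of radius two replaces an ε-net. One factor `2^n` is the volume ratio,
the other the product of `n` row moments; Markov's inequality does the rest. -/
theorem HasSqExpMoment.trainFeatures_sqNorm_mulVec_gt_le {P : Measure (Fin d → ℝ)}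
    [IsProbabilityMeasure P] {c : ℝ} (hc : 0 < c) (hP : HasSqExpMoment P c) {S : Finset (Fin d)}
    (hS : S.card = n) (s : ℝ) :
    trainFeatures P n {A | ∃ v : Fin d → ℝ, (∀ j ∉ S, v j = 0) ∧ sqNorm v ≤ 1 ∧
      s ≤ sqNorm (Matrix.of A *ᵥ v)} ≤ ENNReal.ofReal (4 ^ n * Real.exp (-(c / 4 * s))) := by
  set e := (S.orderEmbOfFin hS).toEmbedding with he
  have hrange : Set.range e = S := S.range_orderEmbOfFin hS
  let L : (Fin n → ℝ) →ₗ[ℝ] (Fin d → ℝ) := Function.ExtendByZero.linearMap ℝ e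
  have hL : ∀ x k, L x (e k) = x k := fun x k => e.injective.extend_apply x 0 k
  have hL0 : ∀ x j, j ∉ S → L x j = 0 := fun x j hj =>
    Function.extend_apply' _ _ _ (by
      rintro ⟨a, rfl⟩
      exact hj (by rw [← Finset.mem_coe, ← hrange]; exact ⟨a, rfl⟩))
  have hLsurj : ∀ v : Fin d → ℝ, (∀ j ∉ S, v j = 0) → L (v ∘ e) = v := fun v hv => by
    funext j
    by_cases hj : j ∈ S
    · have : j ∈ Set.range e := hrange ▸ hj
      obtain ⟨k, rfl⟩ := this
      exact hL _ k
    · rw [hL0 _ _ hj, hv j hj]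
  have hLsq : ∀ x, sqNorm (L x) = sqNorm x := fun x => by
    unfold sqNorm
    rw [← Finset.sum_subset (Finset.subset_univ (Finset.univ.map e)), Finset.sum_map]
    · simp_rw [hL]
    · intro j _ hj
      rw [hL0 x j, zero_pow two_ne_zero]
      intro hjS
      refine hj ?_
      have : j ∈ Set.range e := hrange ▸ hjS
      simpa using this
  have hLm : ∀ j, Measurable fun x => L x j := fun j =>
    (measurable_pi_apply j).comp L.continuous_of_finiteDimensional.measurable
  set D : Set (Fin n → ℝ) := {x | sqNorm x ≤ 4}
  set U : Set (Fin n → ℝ) := {x | sqNorm x ≤ 1} with hU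
  set f : (Fin n → Fin d → ℝ) → (Fin n → ℝ) → ENNReal := fun A x =>
    ENNReal.ofReal (Real.exp (c / 4 * sqNorm (Matrix.of A *ᵥ L x))) with hf
  have hfm : Measurable (Function.uncurry f) := by
    simp only [hf, Function.uncurry_def, sqNorm, Matrix.mulVec, dotProduct, Matrix.of_apply]
    have : ∀ j, Measurable fun z : (Fin n → Fin d → ℝ) × (Fin n → ℝ) => L z.2 j :=
      fun j => (hLm j).comp measurable_snd
    fun_prop
  have hG : ∫⁻ A, (∫⁻ x in D, f A x) ∂(trainFeatures P n) ≤ ENNReal.ofReal (4 ^ n) * volume U := by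
    rw [lintegral_lintegral_swap hfm.aemeasurable]
    refine (setLIntegral_mono' (measurableSet_sqNorm_le _ 4) fun x (hx : sqNorm x ≤ 4) =>
      hP.lintegral_exp_sqNorm_mulVec_le (x := L x) (by rwa [hLsq])).trans_eq ?_
    rw [setLIntegral_const, volume_sqNorm_le_four, ← mul_assoc,
      ← ENNReal.ofReal_mul (by positivity), ← mul_pow,
      show (2 * 2 : ℝ) = 4 by norm_num]
  have hU0 : volume U ≠ 0 := volume_sqNorm_le_one_ne_zero n
  have hUt : volume U ≠ ⊤ := volume_sqNorm_le_one_ne_top n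
  have hexp0 : ENNReal.ofReal (Real.exp (c / 4 * s)) ≠ 0 :=
    (ENNReal.ofReal_pos.mpr (Real.exp_pos _)).ne'
  have hmk := meas_ge_le_lintegral_div (μ := trainFeatures P n)
    (hfm.lintegral_prod_right' (ν := volume.restrict D)).aemeasurable
    (ε := ENNReal.ofReal (Real.exp (c / 4 * s)) * volume U)
    (mul_ne_zero hexp0 hU0) (ENNReal.mul_ne_top ENNReal.ofReal_ne_top hUt)
  refine (measure_mono ?_).trans (hmk.trans ?_)
  · rintro A ⟨v, hvS, hv1, hvs⟩
    have h1 := exp_sqNorm_mul_volume_le ((Matrix.of A).mulVecLin ∘ₗ L) (b := c / 4)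
      (by positivity) (v := v ∘ e) (by rw [← hLsq, hLsurj v hvS]; exact hv1)
    refine le_trans ?_ h1
    refine mul_le_mul_left (ENNReal.ofReal_le_ofReal (Real.exp_le_exp.mpr ?_)) _
    rw [LinearMap.comp_apply, hLsurj v hvS]
    exact mul_le_mul_of_nonneg_left hvs (by positivity)
  · refine (ENNReal.div_le_div_right hG _).trans_eq ?_
    rw [ENNReal.mul_div_mul_right _ _ hU0 hUt, ← ENNReal.ofReal_div_of_pos (Real.exp_pos _),
      Real.exp_neg, div_eq_mul_inv]

/-- With `l = ln(d/n)`, the binomial is at most `exp(nl + n)`, and `l ≥ ln 2` gives `1 + 2 ln 2 ≤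
4l`; together these use five of the six units of `nl`. -/
theorem choose_mul_pow_mul_exp_le (hn : 1 ≤ n) (hd : 2 * n ≤ d) :
    (d.choose n : ℝ) * (4 ^ n * Real.exp (-(6 * (n * Real.log ((d : ℝ) / n))))) ≤
      Real.exp (-(n * Real.log ((d : ℝ) / n))) := by
  have hn0 : (0 : ℝ) < n := by exact_mod_cast hn
  have hd0 : (0 : ℝ) < d := by exact_mod_cast (by omega : 0 < d)
  set l := Real.log ((d : ℝ) / n) with hl
  have hl2 : Real.log 2 ≤ l := by
    refine Real.log_le_log two_pos ?_
    rw [le_div_iff₀ hn0]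
    exact_mod_cast hd
  have h1 : (d.choose n : ℝ) ≤ Real.exp (n * l + n) := by
    refine (Nat.choose_le_pow_div n d).trans ?_
    have h2 : (n : ℝ) ^ n / n.factorial ≤ Real.exp n := Real.pow_div_factorial_le_exp _ hn0.le n
    have h3 : Real.exp (n * l) = (d / n : ℝ) ^ n := by
      rw [Real.exp_nat_mul, hl, Real.exp_log (by positivity)]
    rw [Real.exp_add, h3]
    calc (d : ℝ) ^ n / n.factorial = (d / n : ℝ) ^ n * ((n : ℝ) ^ n / n.factorial) := by
          rw [div_pow]; field_simp
      _ ≤ _ := by gcongr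
  have h4 : (4 : ℝ) ^ n = Real.exp (n * (2 * Real.log 2)) := by
    rw [Real.exp_nat_mul, ← Real.log_rpow two_pos, Real.exp_log (by positivity)]
    norm_num
  refine (mul_le_mul_of_nonneg_right h1 (by positivity)).trans ?_
  rw [h4, ← Real.exp_add, ← Real.exp_add]
  refine Real.exp_le_exp.mpr ?_
  have h5 := Real.log_two_gt_d9
  have h6 : (n : ℝ) * (1 + 2 * Real.log 2) ≤ n * (4 * l) := by
    gcongr; linarith
  linarith

/-- With high probability, all submatrices of `n` columns have squared norm at most a multiple of
`n ln (d / n)`. -/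
theorem HasSqExpMoment.trainFeatures_exists_sqNorm_mulVec_gt_le {P : Measure (Fin d → ℝ)}
    [IsProbabilityMeasure P] {c : ℝ} (hc : 0 < c) (hP : HasSqExpMoment P c) (hn : 1 ≤ n)
    (hd : 2 * n ≤ d) :
    trainFeatures P n {A | ∃ S : Finset (Fin d), S.card = n ∧ ∃ v : Fin d → ℝ,
      (∀ j ∉ S, v j = 0) ∧ sqNorm v ≤ 1 ∧
        24 / c * (n * Real.log ((d : ℝ) / n)) ≤ sqNorm (Matrix.of A *ᵥ v)} ≤
      ENNReal.ofReal (Real.exp (-(n * Real.log ((d : ℝ) / n)))) := by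
  set s := 24 / c * (n * Real.log ((d : ℝ) / n)) with hs
  have hcs : c / 4 * s = 6 * (n * Real.log ((d : ℝ) / n)) := by rw [hs]; field_simp; ring
  calc _ ≤ trainFeatures P n (⋃ S ∈ (Finset.univ : Finset (Fin d)).powersetCard n,
        {A | ∃ v : Fin d → ℝ, (∀ j ∉ S, v j = 0) ∧ sqNorm v ≤ 1 ∧
          s ≤ sqNorm (Matrix.of A *ᵥ v)}) := by
        refine measure_mono ?_
        rintro A ⟨S, hS, hA⟩
        exact Set.mem_biUnion (by simpa using hS) hA
    _ ≤ ∑ S ∈ (Finset.univ : Finset (Fin d)).powersetCard n,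
        trainFeatures P n {A | ∃ v : Fin d → ℝ, (∀ j ∉ S, v j = 0) ∧ sqNorm v ≤ 1 ∧
          s ≤ sqNorm (Matrix.of A *ᵥ v)} := measure_biUnion_finset_le _ _
    _ ≤ ∑ S ∈ (Finset.univ : Finset (Fin d)).powersetCard n,
        ENNReal.ofReal (4 ^ n * Real.exp (-(c / 4 * s))) :=
        Finset.sum_le_sum fun S hS => hP.trainFeatures_sqNorm_mulVec_gt_le hc
          (Finset.mem_powersetCard.mp hS).2 s
    _ = ENNReal.ofReal (d.choose n * (4 ^ n * Real.exp (-(c / 4 * s)))) := by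
        rw [Finset.sum_const, Finset.card_powersetCard, Finset.card_univ, Fintype.card_fin,
          nsmul_eq_mul, ENNReal.ofReal_mul (Nat.cast_nonneg _), ENNReal.ofReal_natCast]
    _ ≤ _ := by
        rw [hcs]
        exact ENNReal.ofReal_le_ofReal (choose_mul_pow_mul_exp_le hn hd)

end ColumnSubmatrices

/-! ### Regularized resolvents -/

section Resolvent

variable {n d : ℕ}

/-- The regularized resolvent `l (l + B)⁻¹` of a positive semidefinite matrix `B`. -/
noncomputable def ridgeResolvent {m : ℕ} (l : ℝ) (B : Matrix (Fin m) (Fin m) ℝ) :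
    Matrix (Fin m) (Fin m) ℝ :=
  l • (l • 1 + B)⁻¹

theorem isUnit_det_smul_one_add {m : ℕ} {l : ℝ} (hl : 0 < l) {B : Matrix (Fin m) (Fin m) ℝ}
    (hB : ∀ x, 0 ≤ x ⬝ᵥ B *ᵥ x) : IsUnit (l • 1 + B).det := by
  rw [isUnit_iff_ne_zero]
  intro h
  obtain ⟨v, hv, h0⟩ := Matrix.exists_mulVec_eq_zero_iff.mpr h
  have h1 : v ⬝ᵥ (l • 1 + B) *ᵥ v = l * sqNorm v + v ⬝ᵥ B *ᵥ v := by
    rw [Matrix.add_mulVec, Matrix.smul_mulVec, Matrix.one_mulVec, dotProduct_add,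
      dotProduct_smul, smul_eq_mul, sqNorm_eq_dotProduct]
  rw [h0, dotProduct_zero] at h1
  have h2 := mul_pos hl (sqNorm_pos hv)
  linarith [hB v]

/-- Substituting `x = (l + B) y` removes the inverse from later computations. -/
theorem ridgeResolvent_form {m : ℕ} {l : ℝ} (hl : 0 < l) {B : Matrix (Fin m) (Fin m) ℝ}
    (hB : ∀ x, 0 ≤ x ⬝ᵥ B *ᵥ x) (x : Fin m → ℝ) :
    ∃ y, x = l • y + B *ᵥ y ∧ ridgeResolvent l B *ᵥ x = l • y ∧
      x ⬝ᵥ ridgeResolvent l B *ᵥ x = l * (l * sqNorm y + y ⬝ᵥ B *ᵥ y) := by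
  have hx : x = l • ((l • 1 + B)⁻¹ *ᵥ x) + B *ᵥ ((l • 1 + B)⁻¹ *ᵥ x) := by
    have : (l • 1 + B) *ᵥ ((l • 1 + B)⁻¹ *ᵥ x) = x := by
      rw [Matrix.mulVec_mulVec, Matrix.mul_nonsing_inv _ (isUnit_det_smul_one_add hl hB),
        Matrix.one_mulVec]
    rw [Matrix.add_mulVec, Matrix.smul_mulVec, Matrix.one_mulVec] at this
    exact this.symm
  have hR : ridgeResolvent l B *ᵥ x = l • ((l • 1 + B)⁻¹ *ᵥ x) := by
    rw [ridgeResolvent, Matrix.smul_mulVec]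
  generalize (l • 1 + B)⁻¹ *ᵥ x = y at hx hR
  refine ⟨y, hx, hR, ?_⟩
  rw [hR, hx, dotProduct_smul, add_dotProduct, smul_dotProduct, smul_eq_mul, smul_eq_mul,
    sqNorm_eq_dotProduct, dotProduct_comm (B *ᵥ y) y]

theorem ridgeResolvent_form_mem_Icc {m : ℕ} {l : ℝ} (hl : 0 < l) {B : Matrix (Fin m) (Fin m) ℝ}
    (hB : ∀ x, 0 ≤ x ⬝ᵥ B *ᵥ x) (x : Fin m → ℝ) :
    0 ≤ x ⬝ᵥ ridgeResolvent l B *ᵥ x ∧ x ⬝ᵥ ridgeResolvent l B *ᵥ x ≤ sqNorm x := by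
  obtain ⟨y, hx, -, hform⟩ := ridgeResolvent_form hl hB x
  have h1 : sqNorm x = l ^ 2 * sqNorm y + 2 * l * (y ⬝ᵥ B *ᵥ y) + sqNorm (B *ᵥ y) := by
    rw [hx]
    simp only [sqNorm_eq_dotProduct, add_dotProduct, dotProduct_add, smul_dotProduct,
      dotProduct_smul, smul_eq_mul, dotProduct_comm (B *ᵥ y) y]
    ring
  have h2 := sqNorm_nonneg y
  have h3 := sqNorm_nonneg (B *ᵥ y)
  have h4 := mul_nonneg hl.le (hB y)
  rw [hform, h1]
  constructor
  · have := hB y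
    positivity
  · linarith

theorem isHermitian_ridgeResolvent {m : ℕ} (l : ℝ) {B : Matrix (Fin m) (Fin m) ℝ} (hB : Bᵀ = B) :
    (ridgeResolvent l B).IsHermitian := by
  rw [Matrix.IsHermitian, Matrix.conjTranspose_eq_transpose_of_trivial, ridgeResolvent,
    Matrix.transpose_smul, Matrix.transpose_nonsing_inv, Matrix.transpose_add,
    Matrix.transpose_smul, Matrix.transpose_one, hB]

theorem dotProduct_gram_mulVec {k m : ℕ} (A : Matrix (Fin k) (Fin m) ℝ) (x : Fin m → ℝ) :
    x ⬝ᵥ (Aᵀ * A) *ᵥ x = sqNorm (A *ᵥ x) := by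
  rw [← Matrix.mulVec_mulVec, Matrix.dotProduct_mulVec, Matrix.vecMul_transpose,
    sqNorm_eq_dotProduct]

theorem gram_nonneg {k m : ℕ} (A : Matrix (Fin k) (Fin m) ℝ) (x : Fin m → ℝ) :
    0 ≤ x ⬝ᵥ (Aᵀ * A) *ᵥ x :=
  dotProduct_gram_mulVec A x ▸ sqNorm_nonneg _

theorem cogram_nonneg {k m : ℕ} (A : Matrix (Fin k) (Fin m) ℝ) (x : Fin k → ℝ) :
    0 ≤ x ⬝ᵥ (A * Aᵀ) *ᵥ x := by
  simpa using gram_nonneg Aᵀ x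

/-- The norm of any interpolator is at least that of the ridge regression objective. -/
theorem ridgeResolvent_form_le_of_mulVec_eq {l : ℝ} (hl : 0 < l) {A : Matrix (Fin n) (Fin d) ℝ}
    {α : Fin d → ℝ} {w : Fin n → ℝ} (h : A *ᵥ α = w) :
    w ⬝ᵥ ridgeResolvent l (A * Aᵀ) *ᵥ w ≤ l * sqNorm α := by
  obtain ⟨y, -, hy, hform⟩ := ridgeResolvent_form hl (cogram_nonneg A) w
  have h1 : y ⬝ᵥ (A * Aᵀ) *ᵥ y = sqNorm (Aᵀ *ᵥ y) := by
    simpa using dotProduct_gram_mulVec Aᵀ y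
  have h2 : w ⬝ᵥ ridgeResolvent l (A * Aᵀ) *ᵥ w = l * (α ⬝ᵥ Aᵀ *ᵥ y) := by
    rw [hy, dotProduct_smul, smul_eq_mul, ← h, Matrix.dotProduct_mulVec α, Matrix.vecMul_transpose]
  -- Nonnegativity of this square gives `α · Aᵀy + l‖y‖² ≤ ‖α‖²`.
  have h3 : sqNorm (α - Aᵀ *ᵥ y) = sqNorm α - 2 * (α ⬝ᵥ Aᵀ *ᵥ y) + sqNorm (Aᵀ *ᵥ y) := by
    simp only [sqNorm_eq_dotProduct, sub_dotProduct, dotProduct_sub,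
      dotProduct_comm (Aᵀ *ᵥ y) α]
    ring
  have h4 := sqNorm_nonneg (α - Aᵀ *ᵥ y)
  have h5 : α ⬝ᵥ Aᵀ *ᵥ y = l * sqNorm y + sqNorm (Aᵀ *ᵥ y) := by
    have := h2.symm.trans hform
    rw [h1] at this
    exact mul_left_cancel₀ hl.ne' this
  have h6 := mul_nonneg hl.le (sqNorm_nonneg y)
  rw [h2]
  exact mul_le_mul_of_nonneg_left (by linarith) hl.le

/-- The push-through identity `(l + AᵀA)⁻¹ Aᵀ = Aᵀ (l + AAᵀ)⁻¹`. -/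
theorem ridgeResolvent_cogram_eq {l : ℝ} (hl : 0 < l) (A : Matrix (Fin n) (Fin d) ℝ) :
    ridgeResolvent l (A * Aᵀ) = 1 - A * (l • 1 + Aᵀ * A)⁻¹ * Aᵀ := by
  have hG := isUnit_det_smul_one_add hl (cogram_nonneg A)
  have hC := isUnit_det_smul_one_add hl (gram_nonneg A)
  have h1 : Aᵀ * (l • 1 + A * Aᵀ) = (l • 1 + Aᵀ * A) * Aᵀ := by
    simp [Matrix.mul_add, Matrix.add_mul, Matrix.mul_assoc]
  have h2 : (l • 1 + Aᵀ * A)⁻¹ * Aᵀ = Aᵀ * (l • 1 + A * Aᵀ)⁻¹ := by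
    calc (l • 1 + Aᵀ * A)⁻¹ * Aᵀ
        = (l • 1 + Aᵀ * A)⁻¹ * (Aᵀ * (l • 1 + A * Aᵀ)) * (l • 1 + A * Aᵀ)⁻¹ := by
          rw [← Matrix.mul_assoc, Matrix.mul_nonsing_inv_cancel_right _ _ hG]
      _ = _ := by rw [h1, Matrix.nonsing_inv_mul_cancel_left _ _ hC]
  have h3 : (l • 1 + A * Aᵀ) * (l • 1 + A * Aᵀ)⁻¹ = 1 := Matrix.mul_nonsing_inv _ hG
  rw [Matrix.mul_assoc, h2, ← Matrix.mul_assoc, ridgeResolvent]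
  rw [Matrix.add_mul, smul_mul_assoc, one_mul] at h3
  exact eq_sub_of_add_eq h3

theorem trace_ridgeResolvent_cogram {l : ℝ} (hl : 0 < l) (A : Matrix (Fin n) (Fin d) ℝ) :
    (ridgeResolvent l (A * Aᵀ)).trace = n - (A * (l • 1 + Aᵀ * A)⁻¹ * Aᵀ).trace := by
  rw [ridgeResolvent_cogram_eq hl, Matrix.trace_sub, Matrix.trace_one, Fintype.card_fin]

/-- `AᵀA` and `AAᵀ` share their nonzero eigenvalues; each zero eigenvalue contributes one to the
trace. -/
theorem trace_ridgeResolvent_gram {l : ℝ} (hl : 0 < l) (A : Matrix (Fin n) (Fin d) ℝ) :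
    (ridgeResolvent l (Aᵀ * A)).trace = d - n + (ridgeResolvent l (A * Aᵀ)).trace := by
  have hC := isUnit_det_smul_one_add hl (gram_nonneg A)
  have h1 : ridgeResolvent l (Aᵀ * A) = 1 - (l • 1 + Aᵀ * A)⁻¹ * (Aᵀ * A) := by
    have h3 : (l • 1 + Aᵀ * A)⁻¹ * (l • 1 + Aᵀ * A) = 1 := Matrix.nonsing_inv_mul _ hC
    rw [Matrix.mul_add, mul_smul_comm, mul_one] at h3
    exact eq_sub_of_add_eq h3
  rw [trace_ridgeResolvent_cogram hl, h1, Matrix.trace_sub, Matrix.trace_one, Fintype.card_fin,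
    ← Matrix.mul_assoc, Matrix.trace_mul_cycle]
  ring

/-- The effect on a resolvent of a rank one perturbation. -/
theorem ridgeResolvent_add_vecMulVec {m : ℕ} {l : ℝ} (hl : 0 < l) {B : Matrix (Fin m) (Fin m) ℝ}
    (hBt : Bᵀ = B) (hB : ∀ x, 0 ≤ x ⬝ᵥ B *ᵥ x) (a : Fin m → ℝ)
    (hB' : ∀ x, 0 ≤ x ⬝ᵥ (B + Matrix.vecMulVec a a) *ᵥ x) :
    a ⬝ᵥ (l • 1 + (B + Matrix.vecMulVec a a))⁻¹ *ᵥ a =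
      1 - l / (l + a ⬝ᵥ ridgeResolvent l B *ᵥ a) ∧
    (ridgeResolvent l (B + Matrix.vecMulVec a a)).trace ≤ (ridgeResolvent l B).trace ∧
    (ridgeResolvent l B).trace ≤ (ridgeResolvent l (B + Matrix.vecMulVec a a)).trace + 1 := by
  have hC := isUnit_det_smul_one_add hl hB'
  have hCj := isUnit_det_smul_one_add hl hB
  set C := l • 1 + (B + Matrix.vecMulVec a a) with hCdef
  set Cj := l • 1 + B with hCjdef
  have hCC : C = Cj + Matrix.vecMulVec a a := by rw [hCdef, hCjdef, add_assoc]
  -- Sherman–Morrison: `C u = (1 + q) a` with `q = ⟨a,u⟩`. The trace drops by `l‖u‖²/(1+q)`, which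
  -- is at most one because `l‖u‖² ≤ q`.
  obtain ⟨u, hu⟩ : ∃ u, u = Cj⁻¹ *ᵥ a := ⟨_, rfl⟩
  have hCju : Cj *ᵥ u = a := by
    rw [hu, Matrix.mulVec_mulVec, Matrix.mul_nonsing_inv _ hCj, Matrix.one_mulVec]
  obtain ⟨q, hq⟩ : ∃ q, q = a ⬝ᵥ u := ⟨_, rfl⟩
  have hqu : l * sqNorm u ≤ q := by
    have h1 : u ⬝ᵥ Cj *ᵥ u = l * sqNorm u + u ⬝ᵥ B *ᵥ u := by
      rw [hCjdef, Matrix.add_mulVec, Matrix.smul_mulVec, Matrix.one_mulVec, dotProduct_add,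
        dotProduct_smul, smul_eq_mul, sqNorm_eq_dotProduct]
    rw [hCju, dotProduct_comm, ← hq] at h1
    linarith [hB u]
  have hun := sqNorm_nonneg u
  have hq0 : 0 ≤ q := le_trans (by positivity) hqu
  have hCu : C *ᵥ u = (1 + q) • a := by
    rw [hCC, Matrix.add_mulVec, hCju, Matrix.vecMulVec_mulVec, ← hq, add_smul, one_smul,
      op_smul_eq_smul]
  have hCa : C⁻¹ *ᵥ a = (1 + q)⁻¹ • u := by
    have h1 : C⁻¹ *ᵥ (C *ᵥ u) = u := by
      rw [Matrix.mulVec_mulVec, Matrix.nonsing_inv_mul _ hC, Matrix.one_mulVec]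
    rw [hCu, Matrix.mulVec_smul] at h1
    rw [← h1, smul_smul, inv_mul_cancel₀ (by positivity), one_smul]
  have hlq : a ⬝ᵥ ridgeResolvent l B *ᵥ a = l * q := by
    rw [ridgeResolvent, Matrix.smul_mulVec, ← hCjdef, ← hu, dotProduct_smul, smul_eq_mul, hq]
  have htr : (ridgeResolvent l B).trace - (ridgeResolvent l (B + Matrix.vecMulVec a a)).trace =
      l * sqNorm u / (1 + q) := by
    have h1 : Cj⁻¹ - C⁻¹ = C⁻¹ * Matrix.vecMulVec a a * Cj⁻¹ := by
      have : Matrix.vecMulVec a a = C - Cj := by rw [hCC, add_sub_cancel_left]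
      rw [this, Matrix.mul_sub, Matrix.sub_mul, Matrix.nonsing_inv_mul _ hC, one_mul,
        Matrix.mul_nonsing_inv_cancel_right _ _ hCj]
    have hsym : a ᵥ* Cj⁻¹ = u := by
      rw [hu, ← Matrix.mulVec_transpose, Matrix.transpose_nonsing_inv, hCjdef,
        Matrix.transpose_add, Matrix.transpose_smul, Matrix.transpose_one, hBt]
    rw [ridgeResolvent, ridgeResolvent, ← Matrix.trace_sub, ← smul_sub, Matrix.trace_smul, ← hCdef,
      ← hCjdef, h1, Matrix.mul_vecMulVec, Matrix.vecMulVec_mul, hsym, hCa,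
      Matrix.trace_vecMulVec, smul_dotProduct, smul_eq_mul, smul_eq_mul, sqNorm_eq_dotProduct]
    ring
  have h1q : 0 < 1 + q := by linarith
  refine ⟨?_, ?_, ?_⟩
  · rw [hlq, hCa, dotProduct_smul, ← hq, smul_eq_mul]
    field_simp
    ring
  · have : 0 ≤ l * sqNorm u / (1 + q) := by positivity
    linarith
  · have : l * sqNorm u / (1 + q) ≤ 1 := by
      rw [div_le_one h1q]; linarith
    linarith

theorem gram_eq_gram_succAbove_add (A : Matrix (Fin (n + 1)) (Fin d) ℝ) (j : Fin (n + 1)) :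
    Aᵀ * A = (A.submatrix j.succAbove id)ᵀ * A.submatrix j.succAbove id +
      Matrix.vecMulVec (A j) (A j) := by
  ext i k
  simp only [Matrix.mul_apply, Matrix.add_apply, Matrix.transpose_apply, Matrix.submatrix_apply,
    Matrix.vecMulVec_apply, id, Fin.sum_univ_succAbove _ j]
  ring

/-- The leave-one-out resolvent: the `j`-th row of `A` is removed. -/
noncomputable def looResolvent (l : ℝ) (A : Matrix (Fin (n + 1)) (Fin d) ℝ) (j : Fin (n + 1)) :
    Matrix (Fin d) (Fin d) ℝ :=
  ridgeResolvent l ((A.submatrix j.succAbove id)ᵀ * A.submatrix j.succAbove id)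

theorem looResolvent_form_nonneg {l : ℝ} (hl : 0 < l) (A : Matrix (Fin (n + 1)) (Fin d) ℝ)
    (j : Fin (n + 1)) : 0 ≤ A j ⬝ᵥ looResolvent l A j *ᵥ A j :=
  (ridgeResolvent_form_mem_Icc hl (gram_nonneg _) _).1

/-- The summands are the diagonal entries of `1 - A(l + AᵀA)⁻¹Aᵀ`. Each is expressed by a row and a
resolvent independent of that row, so that the quadratic-form bound applies. -/
theorem trace_ridgeResolvent_cogram_eq_sum {l : ℝ} (hl : 0 < l)
    (A : Matrix (Fin (n + 1)) (Fin d) ℝ) :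
    (ridgeResolvent l (A * Aᵀ)).trace = ∑ j, l / (l + A j ⬝ᵥ looResolvent l A j *ᵥ A j) := by
  have h1 : (A * (l • 1 + Aᵀ * A)⁻¹ * Aᵀ).trace =
      ∑ j, (1 - l / (l + A j ⬝ᵥ looResolvent l A j *ᵥ A j)) := by
    refine Finset.sum_congr rfl fun j _ => ?_
    have h2 : (A * (l • 1 + Aᵀ * A)⁻¹ * Aᵀ).diag j = A j ⬝ᵥ (l • 1 + Aᵀ * A)⁻¹ *ᵥ A j := by
      rw [Matrix.diag_apply, Matrix.mul_apply', Matrix.dotProduct_mulVec]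
      rfl
    rw [h2]
    have hB' := gram_nonneg A
    rw [gram_eq_gram_succAbove_add A j] at hB' ⊢
    exact (ridgeResolvent_add_vecMulVec hl (by simp [Matrix.transpose_mul]) (gram_nonneg _)
      (A j) hB').1
  rw [trace_ridgeResolvent_cogram hl, h1, Finset.sum_sub_distrib]
  simp

theorem trace_looResolvent_le {l : ℝ} (hl : 0 < l) (A : Matrix (Fin (n + 1)) (Fin d) ℝ)
    (j : Fin (n + 1)) :
    (looResolvent l A j).trace ≤ (ridgeResolvent l (Aᵀ * A)).trace + 1 := by
  have hB' := gram_nonneg A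
  rw [gram_eq_gram_succAbove_add A j] at hB' ⊢
  exact (ridgeResolvent_add_vecMulVec hl (by simp [Matrix.transpose_mul]) (gram_nonneg _)
    (A j) hB').2.2

/-- If the leave-one-out quadratic forms are not too large on average, then the effective
dimension `tr l (l + A Aᵀ)⁻¹` is at least a multiple of `d - n`. -/
theorem le_trace_ridgeResolvent_cogram {c m l : ℝ} (hc : 0 < c) (hc1 : c ≤ 1)
    (hm : m = (d : ℝ) - ((n + 1 : ℕ) : ℝ)) (hm1 : 1 ≤ m) (hmn : m ≤ ((n + 1 : ℕ) : ℝ))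
    (hl : l = m ^ 2 / ((n + 1 : ℕ) : ℝ)) (A : Matrix (Fin (n + 1)) (Fin d) ℝ)
    (hA : ∑ j, Real.exp (c / 2 * (A j ⬝ᵥ looResolvent l A j *ᵥ A j) -
      (looResolvent l A j).trace / 2) < ((n + 1 : ℕ) : ℝ) * Real.exp (4 * m)) :
    c * m / 12 ≤ (ridgeResolvent l (A * Aᵀ)).trace := by
  have hN : (0 : ℝ) < ((n + 1 : ℕ) : ℝ) := by positivity
  have hcard : ∑ _j : Fin (n + 1), (1 : ℝ) = ((n + 1 : ℕ) : ℝ) := by simp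
  set N : ℝ := ((n + 1 : ℕ) : ℝ)
  have hl0 : 0 < l := by rw [hl]; positivity
  have hT := trace_ridgeResolvent_cogram_eq_sum hl0 A
  have hR := trace_ridgeResolvent_gram hl0 A
  rw [← hm] at hR
  have hτ := fun j => trace_looResolvent_le hl0 A j
  have hp := looResolvent_form_nonneg hl0 A
  set T := (ridgeResolvent l (A * Aᵀ)).trace
  set p : Fin (n + 1) → ℝ := fun j => A j ⬝ᵥ looResolvent l A j *ᵥ A j with hpdef
  change T = ∑ j, l / (l + p j) at hT
  have hp0 : ∀ j, 0 ≤ p j := hp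
  have hT0 : 0 ≤ T := hT ▸ Finset.sum_nonneg fun j _ => by have := hp0 j; positivity
  -- The inequality `1 + x ≤ exp x` turns the bound on the exponential average into one on the
  -- average exponent.
  have h1 : ∑ j, (c / 2 * p j - (looResolvent l A j).trace / 2 - 4 * m) ≤ 0 := by
    have h2 : ∀ j, (c / 2 * p j - (looResolvent l A j).trace / 2 - 4 * m) + 1 ≤
        Real.exp (c / 2 * p j - (looResolvent l A j).trace / 2) * Real.exp (-(4 * m)) := fun j => by
      rw [← Real.exp_add, ← sub_eq_add_neg]
      exact Real.add_one_le_exp _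
    have h3 := Finset.sum_le_sum fun j (_ : j ∈ Finset.univ) => h2 j
    rw [Finset.sum_add_distrib, ← Finset.sum_mul, hcard] at h3
    have h4 := mul_le_mul_of_nonneg_right hA.le (Real.exp_pos (-(4 * m))).le
    rw [mul_assoc, ← Real.exp_add, add_neg_cancel, Real.exp_zero, mul_one] at h4
    linarith
  -- Each leave-one-out trace is at most `m + T + 1 ≤ 2m + T`.
  have h5 : c * ∑ j, p j ≤ N * (10 * m + T) := by
    have h6 : ∑ j, (c / 2 * p j - (5 * m + T / 2)) ≤ 0 :=
      (Finset.sum_le_sum fun j _ => by linarith [hτ j]).trans h1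
    rw [Finset.sum_sub_distrib, ← Finset.mul_sum] at h6
    have h7 : ∑ _j : Fin (n + 1), (5 * m + T / 2) = N * (5 * m + T / 2) := by
      rw [← hcard, Finset.sum_mul]; simp
    rw [h7] at h6
    linarith
  -- Cauchy–Schwarz for the terms `l/(l + p_j)` and their reciprocals.
  have h8 : N ^ 2 ≤ T * ∑ j, (1 + p j / l) := by
    rw [hT, ← hcard]
    refine Finset.sum_sq_le_sum_mul_sum_of_sq_le_mul _ (fun j _ => ?_) (fun j _ => ?_)
      (fun j _ => ?_)
    · have := hp0 j; positivity
    · have := hp0 j; positivity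
    · have := hp0 j
      have : l + p j ≠ 0 := by positivity
      refine le_of_eq ?_
      field_simp
  rw [Finset.sum_add_distrib, hcard, ← Finset.sum_div] at h8
  have hNl : N * l = m ^ 2 := by rw [hl]; field_simp
  by_contra! hlt
  have h9 : c * l * N ^ 2 ≤ T * (c * l * N + c * ∑ j, p j) := by
    calc c * l * N ^ 2 ≤ c * l * (T * (N + (∑ j, p j) / l)) := by gcongr
      _ = _ := by field_simp
  have h10 : T * (c * l * N + c * ∑ j, p j) ≤ T * (N * m + N * (10 * m + T)) := by
    refine mul_le_mul_of_nonneg_left (add_le_add ?_ h5) hT0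
    have : c * (N * l) ≤ 1 * (N * m) := by
      rw [hNl]
      refine mul_le_mul hc1 ?_ (by positivity) zero_le_one
      nlinarith
    linarith
  -- If `T < cm/12 ≤ m/12`, the right side is at most `(133/144) c m²`, a contradiction.
  have h11 : c * m ^ 2 ≤ T * (11 * m + T) := by
    have : N * (c * m ^ 2) ≤ N * (T * (11 * m + T)) := by
      calc N * (c * m ^ 2) = c * l * N ^ 2 := by rw [← hNl]; ring
        _ ≤ _ := h9.trans h10
        _ = _ := by ring
    exact le_of_mul_le_mul_left this hN
  have h12 : T ≤ m / 12 := by nlinarith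
  have h13 : T * (11 * m + T) ≤ (c * m / 12) * (11 * m + m / 12) := by gcongr
  have h14 : 0 < c * m ^ 2 := by positivity
  nlinarith

end Resolvent

/-! ### Data matrices that are nearly square -/

section NearlySquare

variable {n d : ℕ}

theorem measurable_inv_apply {X : Type*} [TopologicalSpace X] [MeasurableSpace X]
    [OpensMeasurableSpace X] {m : ℕ} {F : X → Matrix (Fin m) (Fin m) ℝ} (hF : Continuous F)
    (i j : Fin m) : Measurable fun x => (F x)⁻¹ i j := by
  simp only [Matrix.inv_def, Ring.inverse_eq_inv', Matrix.smul_apply, smul_eq_mul]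
  exact (hF.matrix_det.measurable.inv).mul (hF.matrix_adjugate.matrix_elem i j).measurable

theorem measurable_dotProduct_mulVec {X : Type*} [MeasurableSpace X] {m : ℕ}
    {N : X → Matrix (Fin m) (Fin m) ℝ} (hN : ∀ i j, Measurable fun x => N x i j)
    {w : X → Fin m → ℝ} (hw : Measurable w) : Measurable fun x => w x ⬝ᵥ N x *ᵥ w x := by
  unfold Matrix.mulVec dotProduct
  fun_prop

theorem measurable_ridgeResolvent_gram (l : ℝ) (i j : Fin d) :
    Measurable fun A : Fin n → Fin d → ℝ =>
      ridgeResolvent l ((Matrix.of A)ᵀ * Matrix.of A) i j := by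
  have hA : Continuous fun A : Fin n → Fin d → ℝ => Matrix.of A := continuous_id
  exact (measurable_inv_apply (continuous_const.add (hA.matrix_transpose.matrix_mul hA))
    i j).const_mul l

theorem measurable_ridgeResolvent_cogram (l : ℝ) (i j : Fin n) :
    Measurable fun A : Fin n → Fin d → ℝ =>
      ridgeResolvent l (Matrix.of A * (Matrix.of A)ᵀ) i j := by
  have hA : Continuous fun A : Fin n → Fin d → ℝ => Matrix.of A := continuous_id
  exact (measurable_inv_apply (continuous_const.add (hA.matrix_mul hA.matrix_transpose))
    i j).const_mul l

theorem measurable_exp_quadratic_gram (c l : ℝ) :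
    Measurable fun z : (Fin d → ℝ) × (Fin n → Fin d → ℝ) =>
      Real.exp (c / 2 * (z.1 ⬝ᵥ ridgeResolvent l ((Matrix.of z.2)ᵀ * Matrix.of z.2) *ᵥ z.1) -
        (ridgeResolvent l ((Matrix.of z.2)ᵀ * Matrix.of z.2)).trace / 2) := by
  have h : ∀ i j, Measurable fun z : (Fin d → ℝ) × (Fin n → Fin d → ℝ) =>
      ridgeResolvent l ((Matrix.of z.2)ᵀ * Matrix.of z.2) i j := fun i j =>
    (measurable_ridgeResolvent_gram l i j).comp measurable_snd
  simp only [dotProduct, Matrix.mulVec, Matrix.trace, Matrix.diag_apply]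
  fun_prop

/-- Splits row `j` from the others, so that Fubini can integrate it first. -/
theorem exp_looResolvent_eq (c l : ℝ) (A : Fin (n + 1) → Fin d → ℝ) (j : Fin (n + 1)) :
    Real.exp (c / 2 * (A j ⬝ᵥ looResolvent l (Matrix.of A) j *ᵥ A j) -
      (looResolvent l (Matrix.of A) j).trace / 2) =
    (fun z : (Fin d → ℝ) × (Fin n → Fin d → ℝ) =>
      Real.exp (c / 2 * (z.1 ⬝ᵥ ridgeResolvent l ((Matrix.of z.2)ᵀ * Matrix.of z.2) *ᵥ z.1) -
        (ridgeResolvent l ((Matrix.of z.2)ᵀ * Matrix.of z.2)).trace / 2))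
      (MeasurableEquiv.piFinSuccAbove (fun _ => Fin d → ℝ) j A) :=
  rfl

theorem measurable_exp_looResolvent (c l : ℝ) (j : Fin (n + 1)) :
    Measurable fun A : Fin (n + 1) → Fin d → ℝ =>
      Real.exp (c / 2 * (A j ⬝ᵥ looResolvent l (Matrix.of A) j *ᵥ A j) -
        (looResolvent l (Matrix.of A) j).trace / 2) := by
  simp_rw [exp_looResolvent_eq]
  exact (measurable_exp_quadratic_gram c l).comp (MeasurableEquiv.measurable _)

theorem HasSqExpMoment.lintegral_exp_looResolvent_le {P : Measure (Fin d → ℝ)}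
    [IsProbabilityMeasure P] {c l : ℝ} (hc : 0 < c) (hl : 0 < l) (hP : HasSqExpMoment P c)
    (j : Fin (n + 1)) :
    ∫⁻ A, ENNReal.ofReal (Real.exp (c / 2 * (A j ⬝ᵥ looResolvent l (Matrix.of A) j *ᵥ A j) -
      (looResolvent l (Matrix.of A) j).trace / 2)) ∂(trainFeatures P (n + 1)) ≤ 2 := by
  have hm : Measurable fun z : (Fin d → ℝ) × (Fin n → Fin d → ℝ) =>
      ENNReal.ofReal (Real.exp (c / 2 *
        (z.1 ⬝ᵥ ridgeResolvent l ((Matrix.of z.2)ᵀ * Matrix.of z.2) *ᵥ z.1) -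
          (ridgeResolvent l ((Matrix.of z.2)ᵀ * Matrix.of z.2)).trace / 2)) :=
    ENNReal.measurable_ofReal.comp (measurable_exp_quadratic_gram c l)
  simp_rw [exp_looResolvent_eq]
  rw [trainFeatures, (measurePreserving_piFinSuccAbove (fun _ : Fin (n + 1) => P) j).lintegral_comp
    hm, lintegral_prod_symm _ hm.aemeasurable]
  have h : ∀ A' : Fin n → Fin d → ℝ, ∫⁻ a, ENNReal.ofReal (Real.exp (c / 2 *
      (a ⬝ᵥ ridgeResolvent l ((Matrix.of A')ᵀ * Matrix.of A') *ᵥ a) -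
        (ridgeResolvent l ((Matrix.of A')ᵀ * Matrix.of A')).trace / 2)) ∂P ≤ 2 := fun A' =>
    hP.lintegral_exp_quadratic_le hc (isHermitian_ridgeResolvent l (by simp [Matrix.transpose_mul]))
      fun x => ridgeResolvent_form_mem_Icc hl (gram_nonneg _) x
  refine (lintegral_mono fun A' => h A').trans ?_
  simp

/-- Markov is applied to the sum over rows rather than row by row, so the failure probability
carries no factor `n`. -/
theorem HasSqExpMoment.trainFeatures_sum_exp_looResolvent_le {P : Measure (Fin d → ℝ)}
    [IsProbabilityMeasure P] {c l : ℝ} (hc : 0 < c) (hl : 0 < l) (hP : HasSqExpMoment P c)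
    (r : ℝ) :
    trainFeatures P (n + 1) {A | ((n + 1 : ℕ) : ℝ) * Real.exp r ≤
      ∑ j, Real.exp (c / 2 * (A j ⬝ᵥ looResolvent l (Matrix.of A) j *ᵥ A j) -
        (looResolvent l (Matrix.of A) j).trace / 2)} ≤ ENNReal.ofReal (2 * Real.exp (-r)) := by
  have hN : (0 : ℝ) < ((n + 1 : ℕ) : ℝ) := by positivity
  set f : Fin (n + 1) → (Fin (n + 1) → Fin d → ℝ) → ENNReal := fun j A =>
    ENNReal.ofReal (Real.exp (c / 2 * (A j ⬝ᵥ looResolvent l (Matrix.of A) j *ᵥ A j) -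
        (looResolvent l (Matrix.of A) j).trace / 2)) with hf
  have hfm : ∀ j, Measurable (f j) := fun j =>
    ENNReal.measurable_ofReal.comp (measurable_exp_looResolvent c l j)
  have h1 : ∫⁻ A, ∑ j, f j A ∂(trainFeatures P (n + 1)) ≤
      ENNReal.ofReal (((n + 1 : ℕ) : ℝ) * 2) := by
    rw [lintegral_finsetSum _ fun j _ => hfm j]
    refine (Finset.sum_le_card_nsmul _ _ 2 fun j _ =>
      hP.lintegral_exp_looResolvent_le hc hl j).trans_eq ?_
    rw [Finset.card_univ, Fintype.card_fin, nsmul_eq_mul, ENNReal.ofReal_mul (Nat.cast_nonneg _),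
      ENNReal.ofReal_natCast, ENNReal.ofReal_ofNat]
  have hpos : 0 < ((n + 1 : ℕ) : ℝ) * Real.exp r := mul_pos hN (Real.exp_pos r)
  have h2 := meas_ge_le_lintegral_div (μ := trainFeatures P (n + 1))
    (Finset.measurable_sum Finset.univ fun j _ => hfm j).aemeasurable
    (ε := ENNReal.ofReal (((n + 1 : ℕ) : ℝ) * Real.exp r))
    (ENNReal.ofReal_pos.mpr hpos).ne' ENNReal.ofReal_ne_top
  refine (measure_mono fun A hA => ?_).trans (h2.trans ((ENNReal.div_le_div_right h1 _).trans ?_))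
  · simp only [Set.mem_ofPred_eq, hf]
    rw [← ENNReal.ofReal_sum_of_nonneg fun _ _ => (Real.exp_pos _).le]
    exact ENNReal.ofReal_le_ofReal hA
  · rw [← ENNReal.ofReal_div_of_pos hpos, mul_div_mul_left _ _ hN.ne', Real.exp_neg, div_eq_mul_inv]

/-- The noise exponential multiplied by `exp(tr N · log(1+L)/2)` has conditional mean at most one
given the features; Markov then treats the trace and the form jointly. -/
theorem trainLaw_ridge_form_le {P : Measure (Fin d → ℝ)} [IsProbabilityMeasure P] {σ l L s T : ℝ}
    (hσ : 0 < σ) (hl : 0 < l) (hL : 0 ≤ L) :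
    trainLaw P n σ {z | T ≤ (ridgeResolvent l (Matrix.of z.1 * (Matrix.of z.1)ᵀ)).trace ∧
      z.2 ⬝ᵥ ridgeResolvent l (Matrix.of z.1 * (Matrix.of z.1)ᵀ) *ᵥ z.2 ≤ s} ≤
      ENNReal.ofReal (Real.exp (L / (2 * σ ^ 2) * s - T * Real.log (1 + L) / 2)) := by
  have hlog : 0 ≤ Real.log (1 + L) := Real.log_nonneg (by linarith)
  set N : (Fin n → Fin d → ℝ) → Matrix (Fin n) (Fin n) ℝ := fun A =>
    ridgeResolvent l (Matrix.of A * (Matrix.of A)ᵀ) with hNdef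
  have hNm : ∀ i j, Measurable fun z : (Fin n → Fin d → ℝ) × (Fin n → ℝ) => N z.1 i j := fun i j =>
    (measurable_ridgeResolvent_cogram l i j).comp measurable_fst
  set f : (Fin n → Fin d → ℝ) × (Fin n → ℝ) → ENNReal := fun z =>
    ENNReal.ofReal (Real.exp ((N z.1).trace * Real.log (1 + L) / 2)) *
      ENNReal.ofReal (Real.exp (-(L / (2 * σ ^ 2) * (z.2 ⬝ᵥ N z.1 *ᵥ z.2)))) with hf
  have hfm : Measurable f := by
    have hq := measurable_dotProduct_mulVec hNm measurable_snd
    have ht : Measurable fun z : (Fin n → Fin d → ℝ) × (Fin n → ℝ) => (N z.1).trace :=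
      Finset.measurable_sum _ fun i _ => hNm i i
    exact (((ht.mul_const _).div_const 2).exp.ennreal_ofReal).mul
      ((hq.const_mul _).neg.exp.ennreal_ofReal)
  have h1 : ∫⁻ z, f z ∂(trainLaw P n σ) ≤ 1 := by
    rw [trainLaw, lintegral_prod _ hfm.aemeasurable]
    have h2 : ∀ A, ∫⁻ w, f (A, w) ∂(trainNoise n σ) ≤ 1 := fun A => by
      simp only [hf]
      rw [lintegral_const_mul _ (by unfold Matrix.mulVec dotProduct; fun_prop)]
      refine (mul_le_mul_right (lintegral_exp_neg_quadratic_trainNoise_le hσ hL (N := N A)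
        (isHermitian_ridgeResolvent l (by simp [Matrix.transpose_mul]))
        fun x => ridgeResolvent_form_mem_Icc hl (cogram_nonneg _) x) _).trans_eq ?_
      rw [← ENNReal.ofReal_mul (Real.exp_pos _).le, ← Real.exp_add, add_neg_cancel, Real.exp_zero,
        ENNReal.ofReal_one]
    refine (lintegral_mono h2).trans ?_
    simp
  have h3 := meas_ge_le_lintegral_div (μ := trainLaw P n σ) hfm.aemeasurable
    (ε := ENNReal.ofReal (Real.exp (T * Real.log (1 + L) / 2 - L / (2 * σ ^ 2) * s)))
    (ENNReal.ofReal_pos.mpr (Real.exp_pos _)).ne' ENNReal.ofReal_ne_top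
  refine (measure_mono ?_).trans (h3.trans ((ENNReal.div_le_div_right h1 _).trans_eq ?_))
  · rintro z ⟨hT, hs⟩
    change ENNReal.ofReal _ ≤ ENNReal.ofReal _ * ENNReal.ofReal _
    rw [← ENNReal.ofReal_mul (Real.exp_pos _).le, ← Real.exp_add]
    refine ENNReal.ofReal_le_ofReal (Real.exp_le_exp.mpr ?_)
    have h4 : L / (2 * σ ^ 2) * (z.2 ⬝ᵥ N z.1 *ᵥ z.2) ≤ L / (2 * σ ^ 2) * s :=
      mul_le_mul_of_nonneg_left hs (by positivity)
    have h5 : T * Real.log (1 + L) ≤ (N z.1).trace * Real.log (1 + L) :=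
      mul_le_mul_of_nonneg_right hT hlog
    linarith
  · rw [← ENNReal.ofReal_one, ← ENNReal.ofReal_div_of_pos (Real.exp_pos _), one_div,
      ← Real.exp_neg, neg_sub]

theorem trainLaw_fst_le {P : Measure (Fin d → ℝ)} [IsProbabilityMeasure P] (σ : ℝ)
    (s : Set (Fin n → Fin d → ℝ)) : trainLaw P n σ {z | z.1 ∈ s} ≤ trainFeatures P n s := by
  have : {z : (Fin n → Fin d → ℝ) × (Fin n → ℝ) | z.1 ∈ s} = s ×ˢ Set.univ := by ext; simp
  rw [this, trainLaw, Measure.prod_prod, measure_univ, mul_one]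

theorem trainLaw_snd_le {P : Measure (Fin d → ℝ)} [IsProbabilityMeasure P] (σ : ℝ)
    (s : Set (Fin n → ℝ)) : trainLaw P n σ {z | z.2 ∈ s} ≤ trainNoise n σ s := by
  have : {z : (Fin n → Fin d → ℝ) × (Fin n → ℝ) | z.2 ∈ s} = Set.univ ×ˢ s := by ext; simp
  rw [this, trainLaw, Measure.prod_prod, measure_univ, one_mul]

theorem two_mul_exp_add_exp_le {m : ℝ} (hm : 1 ≤ m) :
    2 * Real.exp (-(4 * m)) + Real.exp (m / 2 - 3 * m) ≤ Real.exp (-m) := by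
  have h1 : Real.exp (-(4 * m)) = Real.exp (-m) * Real.exp (-(3 * m)) := by
    rw [← Real.exp_add]; ring_nf
  have h2 : Real.exp (m / 2 - 3 * m) = Real.exp (-m) * Real.exp (-(3 / 2 * m)) := by
    rw [← Real.exp_add]; ring_nf
  have h3 : Real.exp (-(3 * m)) ≤ 1 / 4 := by
    rw [Real.exp_neg, one_div]
    exact inv_anti₀ (by norm_num) (by linarith [Real.add_one_le_exp (3 * m)])
  have h4 : Real.exp (-(3 / 2 * m)) ≤ 2 / 5 := by
    rw [Real.exp_neg, show (2 / 5 : ℝ) = (5 / 2)⁻¹ by norm_num]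
    exact inv_anti₀ (by norm_num) (by linarith [Real.add_one_le_exp (3 / 2 * m)])
  rw [h1, h2]
  nlinarith [Real.exp_pos (-m)]

/-- If `n < d ≤ 2 n`, then with high probability every interpolator of the noise has large norm. -/
theorem HasSqExpMoment.trainLaw_exists_interpolator_le {P : Measure (Fin d → ℝ)}
    [IsProbabilityMeasure P] {c σ : ℝ} (hc : 0 < c) (hc1 : c ≤ 1) (hσ : 0 < σ)
    (hP : HasSqExpMoment P c) (hnd : n < d) (hd : d ≤ 2 * n) :
    trainLaw P n σ {z | ∃ α, Matrix.of z.1 *ᵥ α = z.2 ∧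
      sqNorm α ≤ σ ^ 2 * n / (Real.exp (72 / c) * (d - n))} ≤
      ENNReal.ofReal (Real.exp (-(n * Real.log ((d : ℝ) / n)))) := by
  obtain ⟨n, rfl⟩ : ∃ k, n = k + 1 := ⟨n - 1, by omega⟩
  have hN : (0 : ℝ) < ((n + 1 : ℕ) : ℝ) := by positivity
  obtain ⟨m, hm⟩ : ∃ m : ℝ, m = (d : ℝ) - ((n + 1 : ℕ) : ℝ) := ⟨_, rfl⟩
  have hm1 : 1 ≤ m := by
    have : ((n + 1 : ℕ) : ℝ) + 1 ≤ d := by exact_mod_cast hnd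
    linarith
  have hmn : m ≤ ((n + 1 : ℕ) : ℝ) := by
    have : (d : ℝ) ≤ 2 * ((n + 1 : ℕ) : ℝ) := by exact_mod_cast hd
    linarith
  set N : ℝ := ((n + 1 : ℕ) : ℝ) with hNdef
  -- When the leave-one-out forms are of order `m`, the trace is about `Nl/(l + m)`, which is of
  -- order `m` when `Nl = m²`.
  obtain ⟨l, hl⟩ : ∃ l : ℝ, l = m ^ 2 / N := ⟨_, rfl⟩
  have hl0 : 0 < l := by rw [hl]; positivity
  -- Chosen so that a trace of `cm/12` yields exponent at least `3m`, beating the cost `m/2` of the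
  -- threshold.
  set L := Real.exp (72 / c) with hLdef
  have hL : 0 < L := Real.exp_pos _
  rw [← hm]
  have hT : 3 * m ≤ c * m / 12 * Real.log (1 + L) / 2 := by
    have h1 : 72 / c ≤ Real.log (1 + L) := by
      rw [← Real.log_exp (72 / c)]
      exact Real.log_le_log hL (by linarith)
    calc 3 * m = c * m / 12 * (72 / c) / 2 := by field_simp; norm_num
      _ ≤ _ := by gcongr
  set G : Set (Fin (n + 1) → Fin d → ℝ) := {A | N * Real.exp (4 * m) ≤
      ∑ j, Real.exp (c / 2 * (A j ⬝ᵥ looResolvent l (Matrix.of A) j *ᵥ A j) -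
        (looResolvent l (Matrix.of A) j).trace / 2)} with hG
  calc _ ≤ trainLaw P (n + 1) σ ({z | z.1 ∈ G} ∪
        {z | c * m / 12 ≤ (ridgeResolvent l (Matrix.of z.1 * (Matrix.of z.1)ᵀ)).trace ∧
          z.2 ⬝ᵥ ridgeResolvent l (Matrix.of z.1 * (Matrix.of z.1)ᵀ) *ᵥ z.2 ≤
            l * (σ ^ 2 * N / (L * m))}) := by
        refine measure_mono ?_
        rintro z ⟨α, hα, hle⟩
        by_cases hz : z.1 ∈ G
        · exact Or.inl hz
        refine Or.inr ⟨?_, ?_⟩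
        · exact le_trace_ridgeResolvent_cogram hc hc1 hm hm1 hmn hl (Matrix.of z.1) (not_le.mp hz)
        · exact (ridgeResolvent_form_le_of_mulVec_eq hl0 hα).trans
            (mul_le_mul_of_nonneg_left hle hl0.le)
    _ ≤ ENNReal.ofReal (2 * Real.exp (-(4 * m))) + ENNReal.ofReal
        (Real.exp (L / (2 * σ ^ 2) * (l * (σ ^ 2 * N / (L * m))) -
          c * m / 12 * Real.log (1 + L) / 2)) :=
        (measure_union_le _ _).trans (add_le_add
          ((trainLaw_fst_le σ G).trans (hP.trainFeatures_sum_exp_looResolvent_le hc hl0 _))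
          (trainLaw_ridge_form_le hσ hl0 hL.le))
    _ ≤ ENNReal.ofReal (2 * Real.exp (-(4 * m)) + Real.exp (m / 2 - 3 * m)) := by
        rw [← ENNReal.ofReal_add (by positivity) (Real.exp_pos _).le]
        refine ENNReal.ofReal_le_ofReal ?_
        gcongr
        refine le_of_eq ?_
        rw [hl]
        field_simp
    _ ≤ _ := by
        refine ENNReal.ofReal_le_ofReal ((two_mul_exp_add_exp_le hm1).trans ?_)
        refine Real.exp_le_exp.mpr (neg_le_neg ?_)
        have hd0 : (0 : ℝ) < d := by linarith
        -- The failure probability `exp(-m)` suffices because `n ln(d/n) ≤ d - n`.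
        calc N * Real.log (d / N) ≤ N * (d / N - 1) := by
              gcongr
              exact Real.log_le_sub_one_of_pos (by positivity)
          _ = m := by rw [hm]; field_simp

end NearlySquare

/-! ### The lower bound on the test error -/

section LowerBound

variable {n d : ℕ}

/-- Maximize the sum of moduli over all `n`-subsets; a violated comparison would allow an improving
swap. -/
theorem exists_isTopSet (hnd : n ≤ d) (α : Fin d → ℝ) : ∃ S, IsTopSet n α S := by
  classical
  have hne : ((Finset.univ : Finset (Fin d)).powersetCard n).Nonempty :=
    Finset.powersetCard_nonempty.mpr (by simpa using hnd)
  obtain ⟨S, hS, hmax⟩ := Finset.exists_max_image _ (fun S => ∑ i ∈ S, |α i|) hne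
  have hcard := (Finset.mem_powersetCard.mp hS).2
  refine ⟨S, hcard, fun i hi j hj => ?_⟩
  have hj' : j ∉ S.erase i := fun h => hj (Finset.mem_of_mem_erase h)
  have h := hmax (insert j (S.erase i)) (by
    rw [Finset.mem_powersetCard, Finset.card_insert_of_notMem hj', Finset.card_erase_of_mem hi]
    have := Finset.card_pos.mpr ⟨i, hi⟩
    exact ⟨Finset.subset_univ _, by omega⟩)
  simp only [Finset.sum_insert hj'] at h
  have := Finset.add_sum_erase S (fun i => |α i|) hi
  linarith

theorem sqNorm_truncTo_le (S : Finset (Fin d)) (α : Fin d → ℝ) :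
    sqNorm (truncTo S α) ≤ sqNorm α := by
  refine Finset.sum_le_sum fun i _ => ?_
  unfold truncTo
  split_ifs
  · exact le_rfl
  · simpa using sq_nonneg (α i)

/-- The data on which some interpolator of the noise captures the energy of the noise with its top
`n` entries but has squared norm less than `b`. -/
def smallInterpolatorEvent (n d : ℕ) (b : ℝ) : Set ((Fin n → Fin d → ℝ) × (Fin n → ℝ)) :=
  {z | ∃ α, Matrix.of z.1 *ᵥ α = z.2 ∧
    (∀ S, IsTopSet n α S → sqNorm z.2 ≤ sqNorm (Matrix.of z.1 *ᵥ truncTo S α)) ∧ sqNorm α < b}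

/-- Joins the two regimes; the constant is the sum of what each one needs. -/
theorem HasSqExpMoment.trainLaw_smallInterpolatorEvent_le {P : Measure (Fin d → ℝ)}
    [IsProbabilityMeasure P] {c σ δ : ℝ} (hc : 0 < c) (hc1 : c ≤ 1) (hσ : 0 < σ)
    (hP : HasSqExpMoment P c) (hn : 1 ≤ n) (hnd : n < d) (hδ : 0 < δ) :
    trainLaw P n σ (smallInterpolatorEvent n d
      (mseBound n d σ δ (24 * Real.exp 1 / c + 2 * Real.exp (72 / c)))) ≤ failProb n d δ := by
  have hn0 : (0 : ℝ) < n := by exact_mod_cast hn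
  have hnd' : (n : ℝ) < d := by exact_mod_cast hnd
  have hd0 : (0 : ℝ) < d := by linarith
  have hlog : 0 < Real.log ((d : ℝ) / n) := Real.log_pos ((one_lt_div hn0).mpr hnd')
  have hL : 0 < Real.exp (72 / c) := Real.exp_pos _
  have hE : 0 < Real.exp 1 := Real.exp_pos _
  have hCe : 0 < 24 * Real.exp 1 / c := by positivity
  rcases le_or_gt 1 δ with hδ1 | hδ1
  -- For `δ ≥ 1` the claimed bound is nonpositive, so no vector lies below it.
  · have hempty : smallInterpolatorEvent n d
        (mseBound n d σ δ (24 * Real.exp 1 / c + 2 * Real.exp (72 / c))) = ∅ := by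
      refine Set.eq_empty_of_forall_notMem ?_
      rintro z ⟨α, -, -, hlt⟩
      have h1 := sqNorm_nonneg α
      have h2 : mseBound n d σ δ (24 * Real.exp 1 / c + 2 * Real.exp (72 / c)) ≤ 0 :=
        div_nonpos_of_nonpos_of_nonneg
          (mul_nonpos_of_nonneg_of_nonpos (sq_nonneg σ) (by linarith)) (by positivity)
      linarith
    rw [hempty, measure_empty]
    exact zero_le
  rcases le_or_gt (2 * n) d with hd | hd
  · set l := Real.log ((d : ℝ) / n) with hl
    set E1 : Set (Fin n → Fin d → ℝ) := {A | ∃ S : Finset (Fin d), S.card = n ∧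
      ∃ v : Fin d → ℝ, (∀ j ∉ S, v j = 0) ∧ sqNorm v ≤ 1 ∧
        24 / c * (n * l) ≤ sqNorm (Matrix.of A *ᵥ v)} with hE1
    set E2 : Set (Fin n → ℝ) := {w | sqNorm w ≤ n * σ ^ 2 * ((1 - δ) / Real.exp 1)} with hE2
    have hsub : smallInterpolatorEvent n d
        (mseBound n d σ δ (24 * Real.exp 1 / c + 2 * Real.exp (72 / c))) ⊆
        {z | z.1 ∈ E1} ∪ {z | z.2 ∈ E2} := by
      rintro z ⟨α, -, htop, hlt⟩
      by_cases hz : z.1 ∈ E1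
      · exact Or.inl hz
      refine Or.inr ?_
      obtain ⟨S, hS⟩ := exists_isTopSet hnd.le α
      have hsupp : ∀ j ∉ S, truncTo S α j = 0 := fun j hj => by simp [truncTo, hj]
      have hop : sqNorm (Matrix.of z.1 *ᵥ truncTo S α) ≤
          24 / c * (n * l) * sqNorm (truncTo S α) := by
        by_cases h0 : truncTo S α = 0
        · rw [h0, Matrix.mulVec_zero]; simp [sqNorm]
        have hpos := sqNorm_pos h0
        by_contra! hgt
        refine hz ⟨S, hS.1, (√(sqNorm (truncTo S α)))⁻¹ • truncTo S α, fun j hj => ?_, ?_, ?_⟩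
        · rw [Pi.smul_apply, hsupp j hj, smul_zero]
        · rw [sqNorm_smul, inv_pow, Real.sq_sqrt hpos.le, inv_mul_cancel₀ hpos.ne']
        · rw [Matrix.mulVec_smul, sqNorm_smul, inv_pow, Real.sq_sqrt hpos.le, inv_mul_eq_div,
            le_div_iff₀ hpos]
          exact hgt.le
      calc sqNorm z.2 ≤ 24 / c * (n * l) * sqNorm (truncTo S α) := (htop S hS).trans hop
        _ ≤ 24 / c * (n * l) *
            mseBound n d σ δ (24 * Real.exp 1 / c + 2 * Real.exp (72 / c)) := by
            gcongr
            exact (sqNorm_truncTo_le S α).trans hlt.le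
        _ ≤ 24 / c * (n * l) * (σ ^ 2 * (1 - δ) / (24 * Real.exp 1 / c * l)) := by
            unfold mseBound
            have h1δ : 0 ≤ 1 - δ := sub_nonneg.mpr hδ1.le
            gcongr
            exact le_add_of_nonneg_right (by positivity)
        _ = n * σ ^ 2 * ((1 - δ) / Real.exp 1) := by field_simp
    refine (measure_mono hsub).trans ((measure_union_le _ _).trans ?_)
    rw [failProb, ENNReal.ofReal_add (Real.exp_pos _).le (Real.exp_pos _).le]
    exact add_le_add
      ((trainLaw_fst_le σ E1).trans (hP.trainFeatures_exists_sqNorm_mulVec_gt_le hc hn hd))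
      ((trainLaw_snd_le σ E2).trans (trainNoise_sqNorm_le_le hσ hδ hδ1))
  · have hd' : (d : ℝ) ≤ 2 * n := by exact_mod_cast hd.le
    have hm : (0 : ℝ) < d - n := by linarith
    -- From `ln x ≥ 1 - 1/x` and `d ≤ 2n`; it converts the bound by `n/(d - n)` into one by
    -- `1/ln(d/n)`.
    have hlog2 : ((d : ℝ) - n) / (2 * n) ≤ Real.log ((d : ℝ) / n) := by
      have h1 := Real.one_sub_inv_le_log_of_pos (show (0 : ℝ) < d / n by positivity)
      refine le_trans ?_ h1
      rw [inv_div, one_sub_div hd0.ne']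
      gcongr
    refine le_trans (measure_mono ?_) ((hP.trainLaw_exists_interpolator_le hc hc1 hσ hnd
      hd.le).trans (ENNReal.ofReal_le_ofReal (le_add_of_nonneg_right (Real.exp_pos _).le)))
    rintro z ⟨α, hα, -, hlt⟩
    refine ⟨α, hα, hlt.le.trans ?_⟩
    calc mseBound n d σ δ (24 * Real.exp 1 / c + 2 * Real.exp (72 / c))
        ≤ σ ^ 2 * 1 / (2 * Real.exp (72 / c) * (((d : ℝ) - n) / (2 * n))) := by
          unfold mseBound
          gcongr
          · linarith
          · linarith
      _ = σ ^ 2 * n / (Real.exp (72 / c) * (d - n)) := by field_simp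

theorem outputs_zero (A : Matrix (Fin n) (Fin d) ℝ) (w : Fin n → ℝ) : outputs A 0 w = w := by
  rw [outputs, Matrix.mulVec_zero, zero_add]

/-- Outside a null set, the outcome of basis pursuit is as desired unless there is a small
interpolator. -/
theorem trainLaw_not_bpOutcome_le {P : Measure (Fin d → ℝ)} [IsProbabilityMeasure P]
    (hW : IsWhitened P) (hnd : n < d) {σ : ℝ} (hσ : 0 < σ)
    (hA : ∀ᵐ A ∂(trainFeatures P n), IsNondegenerate (Matrix.of A)) (b : ℝ) :
    trainLaw P n σ {z | ¬ BPOutcome P σ 0 b (Matrix.of z.1) z.2} ≤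
      trainLaw P n σ (smallInterpolatorEvent n d b) := by
  have h1 : ∀ᵐ z ∂(trainLaw P n σ), IsNondegenerate (Matrix.of z.1) :=
    Measure.quasiMeasurePreserving_fst.ae hA
  refine measure_mono_ae ?_
  filter_upwards [h1, ae_trainLaw_cramer_ne_zero hA hσ] with z hz hcr hbad
  by_contra hsmall
  refine hbad ?_
  obtain ⟨α, hα, huniq⟩ := hz.existsUnique hnd.le z.2
  have hle := hz.l0Norm_le hnd.le hα
  rw [BPOutcome, outputs_zero]
  refine ⟨α, hα, huniq, hle.antisymm (not_lt.mp fun hlt => ?_), ?_⟩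
  · obtain ⟨e, i, h⟩ := exists_cramer_eq_zero_of_l0Norm_lt hnd.le hα.1 hlt
    exact hcr e i h
  · rw [hW.testMSE_zero]
    refine not_lt.mp fun hlt => hsmall ⟨α, hα.1, fun S hS => ?_, hlt⟩
    rw [truncTo_eq_self_of_l0Norm_le hS hle, hα.1]

theorem setOf_isParsimonious_testMSE_lt_subset {P : Measure (Fin d → ℝ)} [IsProbabilityMeasure P]
    (hW : IsWhitened P) (σ b : ℝ) :
    {z : (Fin n → Fin d → ℝ) × (Fin n → ℝ) | ∃ op, IsBPOperator (Matrix.of z.1) op ∧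
      IsParsimonious (Matrix.of z.1) 1 op ∧
        testMSE P σ 0 (op (outputs (Matrix.of z.1) 0 z.2)) < b} ⊆
      smallInterpolatorEvent n d b := by
  rintro z ⟨op, -, hop, hlt⟩
  rw [outputs_zero, hW.testMSE_zero] at hlt
  exact ⟨op z.2, hop.1 z.2, fun S hS => by simpa using hop.2 z.2 S hS, hlt⟩

theorem l0Norm_zero_le (d k : ℕ) : l0Norm (0 : Fin d → ℝ) ≤ k := by
  simp [l0Norm]

end LowerBound

theorem corollary4 :
    -- Whenever interpolation is feasible, basis pursuit has a 1-parsimonious solution operator.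
    (∀ (n d : ℕ) (A : Matrix (Fin n) (Fin d) ℝ), A.rank = n →
      ∃ op, IsBPOperator A op ∧ IsParsimonious A 1 op) ∧
    -- For a non-degenerate data matrix the solution is unique for every output, basis pursuit is
    -- 1-parsimonious, and almost surely over the noise the support has size exactly `n`.
    (∀ (n d : ℕ), n < d → ∀ A : Matrix (Fin n) (Fin d) ℝ, IsNondegenerate A →
      (∀ Y, ∃! α, IsMinL1Interpolator A Y α) ∧
      (∀ op, IsBPOperator A op → IsParsimonious A 1 op) ∧
      (∀ (σ : ℝ), 0 < σ → ∀ αstar : Fin d → ℝ, ∀ᵐ w ∂(trainNoise n σ),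
        ∀ α, IsMinL1Interpolator A (outputs A αstar w) α → l0Norm α = n)) ∧
    -- Non-degeneracy is generic: it holds almost surely for iid rows whose law has a density,
    -- in particular for Gaussian features.
    (∀ (n d : ℕ), n < d → ∀ P : Measure (Fin d → ℝ), IsProbabilityMeasure P →
      P ≪ volume → ∀ᵐ A ∂(trainFeatures P n), IsNondegenerate (Matrix.of A)) ∧
    (∀ (n d : ℕ), n < d →
      ∀ᵐ A ∂(trainFeatures (gaussianFeatures d) n), IsNondegenerate (Matrix.of A)) ∧
    -- Gaussian features: the lower bound on the test MSE, with a universal constant.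
    (∃ C : ℝ, 0 < C ∧ ∀ (n d : ℕ), 1 ≤ n → n < d → ∀ σ : ℝ, 0 < σ → ∀ k : ℕ,
      ∃ αstar : Fin d → ℝ, l0Norm αstar ≤ k ∧ ∀ δ : ℝ, 0 < δ →
        trainLaw (gaussianFeatures d) n σ
          {z | ¬ BPOutcome (gaussianFeatures d) σ αstar (mseBound n d σ δ C)
            (Matrix.of z.1) z.2} ≤ failProb n d δ) ∧
    -- Sub-Gaussian features: the lower bound, with a constant that depends only on `K`, for every
    -- 1-parsimonious basis pursuit operator, and for the basis pursuit solution itself when the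
    -- data matrix is almost surely non-degenerate.
    (∀ K : ℝ, 0 < K → ∃ C : ℝ, 0 < C ∧ ∀ (n d : ℕ), 1 ≤ n → n < d → ∀ σ : ℝ, 0 < σ →
      ∀ P : Measure (Fin d → ℝ), IsProbabilityMeasure P → IsWhitened P → IsSubGaussianVec P K →
      ∀ k : ℕ, ∃ αstar : Fin d → ℝ, l0Norm αstar ≤ k ∧ ∀ δ : ℝ, 0 < δ →
        trainLaw P n σ
          {z | ∃ op, IsBPOperator (Matrix.of z.1) op ∧ IsParsimonious (Matrix.of z.1) 1 op ∧
            testMSE P σ αstar (op (outputs (Matrix.of z.1) αstar z.2)) < mseBound n d σ δ C}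
          ≤ failProb n d δ ∧
        ((∀ᵐ A ∂(trainFeatures P n), IsNondegenerate (Matrix.of A)) →
          trainLaw P n σ
            {z | ¬ BPOutcome P σ αstar (mseBound n d σ δ C) (Matrix.of z.1) z.2}
            ≤ failProb n d δ)) := by
  refine ⟨fun n d A hA => ?_, fun n d hnd A hA => ⟨hA.existsUnique hnd.le,
    fun op hop => hA.isParsimonious hnd.le hop, fun σ hσ αstar => hA.ae_l0Norm_eq hnd.le hσ αstar⟩,
    fun n d _ P _ hP => (ChargesNoHyperplane.of_absolutelyContinuous hP).ae_isNondegenerate,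
    fun n d _ => (chargesNoHyperplane_gaussianFeatures d).ae_isNondegenerate, ?_, fun K hK => ?_⟩
  · obtain ⟨op, hop, -, hpars⟩ := exists_isBPOperator_isParsimonious hA
    exact ⟨op, hop, hpars⟩
  · refine ⟨24 * Real.exp 1 / (3 / 8) + 2 * Real.exp (72 / (3 / 8)), by positivity,
      fun n d hn hnd σ hσ k => ⟨0, l0Norm_zero_le d k, fun δ hδ => ?_⟩⟩
    exact (trainLaw_not_bpOutcome_le (isWhitened_gaussianFeatures d) hnd hσ
      (chargesNoHyperplane_gaussianFeatures d).ae_isNondegenerate _).trans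
        ((hasSqExpMoment_gaussianFeatures d).trainLaw_smallInterpolatorEvent_le (by norm_num)
          (by norm_num) hσ hn hnd hδ)
  · obtain ⟨c, hc, hc1, hcK⟩ : ∃ c : ℝ, 0 < c ∧ c ≤ 1 ∧
        c * (2 * Real.exp 1 * K ^ 2) ≤ 1 / 2 := by
      -- The cap at one is required by the estimate for nearly square matrices.
      refine ⟨min 1 (1 / 2 / (2 * Real.exp 1 * K ^ 2)), by positivity, min_le_left _ _, ?_⟩
      rw [← le_div_iff₀ (by positivity)]
      exact min_le_right _ _
    refine ⟨24 * Real.exp 1 / c + 2 * Real.exp (72 / c), by positivity,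
      fun n d hn hnd σ hσ P _ hW hsub k => ⟨0, l0Norm_zero_le d k, fun δ hδ => ?_⟩⟩
    have hmain := (hsub.hasSqExpMoment hK hc hcK).trainLaw_smallInterpolatorEvent_le hc hc1 hσ hn
      hnd hδ
    exact ⟨(measure_mono (setOf_isParsimonious_testMSE_lt_subset hW σ _)).trans hmain,
      fun hA => (trainLaw_not_bpOutcome_le hW hnd hσ hA _).trans hmain⟩
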